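/- **Setting.** Let $n,q\ge 0$ be integers. Two adversaries, Alice and Bob, attack a single-round BB84 position-verification protocol with basis function $f:\{0,1\}^{n}\times\{0,1\}^n\to\{0,1\}$ and uniformly random inputs $x,y\in\{0,1\}^n$. A *$q$-qubit sub-strategy* consists of a mixed state $\sigma_{AB}$ of $q+q$ qubits, channels (CPTP maps) $\mathcal E^{x}_{AQ}$ on $q+1$ qubits and $\mathcal E^{y}_{B}$ on $q$ qubits, a splitting of the output qubits $AQ\to A_1A_2$, $B\to B_1B_2$, and, after $A_2$ and $B_2$ have been exchanged, POVMs $\{A^{xy}_z\}$ on $A'=A_1B_2$ and $\{B^{xy}_z\}$ on $B'=B_1A_2$ with outcomes $z\in\{0,1,\perp\}$. The verifier holds the half $V$ of a Bell pair $|\Phi^+\rangle_{VQ}$, whose half $Q$ Alice receives; $\rho^{xy}_{A'B'V}$ is the state before the measurements. With $\Pi^0_z$ and $\Pi^1_z$ the projectors of the $Z$- and the $X$-basis, put $$p_{e|xy}=\sum_{z\in\{0,1\}}\mathrm{Tr}[(\Pi^{f(x,y)}_z\otimes A^{xy}_{\bar z}\otimes B^{xy}_{\bar z})\rho^{xy}_{A'B'V}],\qquad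 p_{t|xy}=1-\mathrm{Tr}[(\mathbb I_V\otimes A^{xy}_\perp\otimes B^{xy}_\perp)\rho^{xy}_{A'B'V}];$$ the *matching condition* at $(x,y)$ is $\mathrm{Tr}[(\mathbb I_V\otimes A^{xy}_z\otimes B^{xy}_{z'})\rho^{xy}_{A'B'V}]=0$ for all $z\neq z'$ in $\{0,1,\perp\}$. A *$q$-qubit strategy* is a family of sub-strategies indexed by the values $r$ of a discrete shared random variable with distribution $\{p_r\}_r$; a further index $r$ refers to the $r$-th sub-strategy. It is a *$(\{p_r\}_r,\varepsilon,\eta)$-strategy with $(\varepsilon_{\rm thres},\eta_{\rm thres},\{l_{1,r},l_{2,r},l_{3,r},l_{4,r}\}_r)$-partition* for $f$ if its transmission is $\eta=\sum_r p_r2^{-2n}\sum_{x,y}p_{t|rxy}$, its error rate conditioned on detection is $\varepsilon=\frac1\eta\sum_r p_r2^{-2n}\sum_{x,y}p_{e|rxy}$, and for each $r$ the numbers of pairs $(x,y)$ that satisfy the matching condition and, respectively, ($p_{e|rxy}\le\varepsilon_{\rm thres}\eta$, $p_{t|rxy}\ge\eta_{\rm thres}$), ($p_{e|rxy}\le\varepsilon_{\rm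 thres}\eta$, $p_{t|rxy}<\eta_{\rm thres}$), ($p_{e|rxy}>\varepsilon_{\rm thres}\eta$, $p_{t|rxy}\ge\eta_{\rm thres}$), ($p_{e|rxy}>\varepsilon_{\rm thres}\eta$, $p_{t|rxy}<\eta_{\rm thres}$) are $l_{1,r},\dots,l_{4,r}$, with $\sum_i l_{i,r}=2^{2n}$. For $\theta\in\{0,1\}$ and a fixed splitting of the output qubits let $\mathcal S_\theta^{\tilde\varepsilon,\tilde\eta}$ be the set of vectors $(U_{AQP_A}\otimes U_{BP_B})(|\Phi^+\rangle_{VQ}\otimes|\psi\rangle_{ABP}\otimes|00\rangle_{P_AP_B})$, with $U_{AQP_A},U_{BP_B}$ unitary, $\psi$ a unit vector, and purifying systems $P,P_A,P_B$ of $2q$, $2(q+1)$, $2q$ qubits, for which there are POVMs $\{A_z\}$ on $A'$ and $\{B_z\}$ on $B'$ with error probability $p_{e}\le\tilde\varepsilon$ in the basis $\theta$, transmission $p_t\ge\tilde\eta$, and zero probability of unequal responses. **Theorem.** Let $q_0\in\mathbb R$, $\alpha\ge0$, $\varepsilon_{\rm thres}\ge0$, $0\le\eta_{\rm thres}<1$,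 $\eta>0$, and let $q\le\frac16n-q_0$. Let $\tilde\delta>0$ be such that, for every splitting, $\frac12\big\||\Psi_0\rangle\langle\Psi_0|-|\Psi_1\rangle\langle\Psi_1|\big\|_1\ge\tilde\delta$ for all $\Psi_0\in\mathcal S_0^{\varepsilon_{\rm thres}\eta,\eta_{\rm thres}}$ and $\Psi_1\in\mathcal S_1^{\varepsilon_{\rm thres}\eta,\eta_{\rm thres}}$. Let $\nu\in[0,\frac12]$ satisfy $$h_b(\nu)=1-2^{9-6q_0}\left[\left\lceil\log_2\left(1+\tfrac{12}{\tilde\delta}\right)\right\rceil+1\right]-\frac{\alpha}{2^{2n}},$$ where $h_b$ is the binary entropy function (base 2). Let $f:\{0,1\}^{n}\times\{0,1\}^n\to\{0,1\}$ be uniformly random. Then: 1. With probability at least $1-2^{-\alpha}$ over $f$, every $q$-qubit $(\{p_r\}_r,\varepsilon,\eta)$-strategy for $f$ with $(\varepsilon_{\rm thres},\eta_{\rm thres},\{l_{i,r}\})$-partition, for any $\{p_r\}_r$ and any $\{l_{i,r}\}$, has $\varepsilon\ge\left(\frac{\eta-\eta_{\rm thres}}{1-\eta_{\rm thres}}-1+\nu\right)\varepsilon_{\rm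 thres}$. 2. If for each $f$ the adversaries use any such strategy, of transmission $\eta$ and error rate conditioned on detection $\varepsilon_f$ (the strategy, its shared randomness and its partition may depend on $f$), then the error rate conditioned on detection, averaged over the random $f$, satisfies $$\mathbb E_f[\varepsilon_f]\ \ge\ (1-2^{-\alpha})\left(\frac{\eta-\eta_{\rm thres}}{1-\eta_{\rm thres}}-1+\nu\right)\varepsilon_{\rm thres}.$$ -/

import Mathlib

open scoped Matrix Kronecker ComplexOrder

noncomputable section

namespace QPV

/-! ### Finite-dimensional quantum theory -/

/-- Basis labels of a system of `k` qubits, whose Hilbert space is `ℂ^(2^k)`. -/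
abbrev Qubits (k : ℕ) : Type := Fin (2 ^ k)

/-- Density matrices: positive semidefinite matrices of unit trace. -/
structure DensityMatrix (ι : Type) [Fintype ι] where
  mat : Matrix ι ι ℂ
  posSemidef : mat.PosSemidef
  trace_eq_one : mat.trace = 1

/-- `Φ ⊗ id`: a map on matrices acting on the first tensor factor. -/
def mapFst {m m' k : Type} (Φ : Matrix m m ℂ → Matrix m' m' ℂ)
    (M : Matrix (m × k) (m × k) ℂ) : Matrix (m' × k) (m' × k) ℂ :=
  Matrix.of fun p p' => Φ (Matrix.of fun i j => M (i, p.2) (j, p'.2)) p.1 p'.1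

/-- `id ⊗ Φ`: a map on matrices acting on the second tensor factor. -/
def mapSnd {k m m' : Type} (Φ : Matrix m m ℂ → Matrix m' m' ℂ)
    (M : Matrix (k × m) (k × m) ℂ) : Matrix (k × m') (k × m') ℂ :=
  Matrix.of fun p p' => Φ (Matrix.of fun i j => M (p.1, i) (p'.1, j)) p.2 p'.2

/-- Quantum channels: completely positive trace-preserving linear maps. -/
structure Channel (m m' : Type) [Fintype m] [Fintype m'] where
  toLin : Matrix m m ℂ →ₗ[ℂ] Matrix m' m' ℂ
  completelyPositive : ∀ (k : ℕ) (M : Matrix (Fin k × m) (Fin k × m) ℂ),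
    M.PosSemidef → (mapSnd toLin M).PosSemidef
  tracePreserving : ∀ M : Matrix m m ℂ, (toLin M).trace = M.trace

/-- The possible responses: a bit `some z`, or `none`, which stands for "no detection" (`⊥`). -/
abbrev Response : Type := Option Bool

/-- POVMs with outcomes `0`, `1`, `⊥`. -/
structure POVM (ι : Type) [Fintype ι] [DecidableEq ι] where
  op : Response → Matrix ι ι ℂ
  posSemidef : ∀ z, (op z).PosSemidef
  sum_eq_one : ∑ z, op z = 1

/-- The trace norm: the sum of the singular values. -/
def traceNorm {ι : Type} [Fintype ι] [DecidableEq ι] (M : Matrix ι ι ℂ) : ℝ :=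
  ∑ i, Real.sqrt ((Matrix.isHermitian_conjTranspose_mul_self M).eigenvalues i)

/-- The trace distance `‖ρ - σ‖₁ / 2`. -/
def traceDist {ι : Type} [Fintype ι] [DecidableEq ι] (ρ σ : Matrix ι ι ℂ) : ℝ :=
  traceNorm (ρ - σ) / 2

/-- The projector `|ψ⟩⟨ψ|`. -/
def dyad {ι : Type} (ψ : ι → ℂ) : Matrix ι ι ℂ := Matrix.vecMulVec ψ (star ψ)

/-- The amplitudes of the Bell state `(|00⟩ + |11⟩) / √2`. -/
def bell (i j : Fin 2) : ℂ := if i = j then ((Real.sqrt 2 : ℝ) : ℂ)⁻¹ else 0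

/-- The BB84 states `|ψ^θ_z⟩`: for `θ = false` the `Z`-basis `|0⟩, |1⟩`, for `θ = true` the
`X`-basis `(|0⟩ + |1⟩)/√2, (|0⟩ - |1⟩)/√2`. -/
def bb84 (θ z : Bool) : Fin 2 → ℂ :=
  match θ, z with
  | false, false => ![1, 0]
  | false, true => ![0, 1]
  | true, false => fun _ => ((Real.sqrt 2 : ℝ) : ℂ)⁻¹
  | true, true => ![((Real.sqrt 2 : ℝ) : ℂ)⁻¹, -((Real.sqrt 2 : ℝ) : ℂ)⁻¹]

/-! ### The exchange of subsystems and the response probabilities -/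

/-- How the `q + 1` qubits of Alice and the `q` qubits of Bob are divided into a part that is kept
(`A₁`, `B₁`) and a part that is sent to the other party (`A₂`, `B₂`). -/
structure Split (q : ℕ) where
  a₁ : ℕ
  a₂ : ℕ
  b₁ : ℕ
  b₂ : ℕ
  alice_eq : a₁ + a₂ = q + 1
  bob_eq : b₁ + b₂ = q

namespace Split

variable {q : ℕ} (s : Split q)

/-- Alice's output system `A₁A₂`. -/
abbrev AOut : Type := Qubits s.a₁ × Qubits s.a₂

/-- Bob's output system `B₁B₂`. -/
abbrev BOut : Type := Qubits s.b₁ × Qubits s.b₂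

/-- Alice's system `A' = A₁B₂` after the exchange. -/
abbrev ARecv : Type := Qubits s.a₁ × Qubits s.b₂

/-- Bob's system `B' = B₁A₂` after the exchange. -/
abbrev BRecv : Type := Qubits s.b₁ × Qubits s.a₂

/-- The verifier's qubit `V` together with `A₁A₂` and `B₁B₂`. -/
abbrev Final : Type := Fin 2 × (s.AOut × s.BOut)

/-- The operator `P_V ⊗ E_{A'} ⊗ F_{B'}`, written on `V(A₁A₂)(B₁B₂)`. -/
def jointOp (P : Matrix (Fin 2) (Fin 2) ℂ) (E : Matrix s.ARecv s.ARecv ℂ)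
    (F : Matrix s.BRecv s.BRecv ℂ) : Matrix s.Final s.Final ℂ :=
  Matrix.of fun i j =>
    P i.1 j.1 * E (i.2.1.1, i.2.2.2) (j.2.1.1, j.2.2.2) * F (i.2.2.1, i.2.1.2) (j.2.2.1, j.2.1.2)

/-- `Tr[(P_V ⊗ E_{A'} ⊗ F_{B'}) ρ]`. -/
def prob (ρ : Matrix s.Final s.Final ℂ) (P : Matrix (Fin 2) (Fin 2) ℂ)
    (E : Matrix s.ARecv s.ARecv ℂ) (F : Matrix s.BRecv s.BRecv ℂ) : ℝ :=
  (s.jointOp P E F * ρ).trace.re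

/-- The error probability `p_e = ∑_z Tr[(Π_z^θ ⊗ A_{1-z} ⊗ B_{1-z}) ρ]` for the basis `θ`. -/
def errorProb (ρ : Matrix s.Final s.Final ℂ) (A : POVM s.ARecv) (B : POVM s.BRecv)
    (θ : Bool) : ℝ :=
  ∑ z : Bool, s.prob ρ (dyad (bb84 θ z)) (A.op (some (!z))) (B.op (some (!z)))

/-- The transmission probability `p_t = 1 - Tr[(1 ⊗ A_⊥ ⊗ B_⊥) ρ]`. -/
def transProb (ρ : Matrix s.Final s.Final ℂ) (A : POVM s.ARecv) (B : POVM s.BRecv) : ℝ :=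
  1 - s.prob ρ 1 (A.op none) (B.op none)

/-- The matching condition: different responses of Alice and Bob have probability zero. -/
def Matching (ρ : Matrix s.Final s.Final ℂ) (A : POVM s.ARecv) (B : POVM s.BRecv) : Prop :=
  ∀ z z' : Response, z ≠ z' → s.prob ρ 1 (A.op z) (B.op z') = 0

end Split

/-! ### Strategies of the adversaries -/

/-- Input strings of the verifiers. -/
abbrev Bits (n : ℕ) : Type := Fin n → Bool

/-- Functions `f : {0,1}^n × {0,1}^n → {0,1}`, which select the basis. -/
abbrev BasisFun (n : ℕ) : Type := Bits n × Bits n → Bool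

/-- A sub-strategy, i.e. the strategy for one value of the shared randomness: a mixed state of
`2q` qubits on `AB`, channels acting on `AQ` and on `B` depending on `x` and on `y` respectively,
and POVMs after the exchange of subsystems, depending on `(x, y)`. -/
structure SubStrategy (n q : ℕ) where
  split : Split q
  state : DensityMatrix (Qubits q × Qubits q)
  chanA : Bits n → Channel (Qubits q × Fin 2) split.AOut
  chanB : Bits n → Channel (Qubits q) split.BOut
  povmA : Bits n × Bits n → POVM split.ARecv
  povmB : Bits n × Bits n → POVM split.BRecv

/-- The state `|Φ⁺⟩⟨Φ⁺|_{VQ} ⊗ σ_{AB}`, written on `V(AQ)B`. -/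
def inputState {q : ℕ} (σ : Matrix (Qubits q × Qubits q) (Qubits q × Qubits q) ℂ) :
    Matrix (Fin 2 × ((Qubits q × Fin 2) × Qubits q))
      (Fin 2 × ((Qubits q × Fin 2) × Qubits q)) ℂ :=
  Matrix.of fun i j =>
    bell i.1 i.2.1.2 * star (bell j.1 j.2.1.2) * σ (i.2.1.1, i.2.2) (j.2.1.1, j.2.2)

namespace SubStrategy

variable {n q : ℕ} (s : SubStrategy n q)

/-- The state of the verifier, Alice and Bob before their measurements, for inputs `(x, y)`. -/
def finalState (xy : Bits n × Bits n) : Matrix s.split.Final s.split.Final ℂ :=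
  mapSnd (fun N => mapFst (s.chanA xy.1).toLin (mapSnd (s.chanB xy.2).toLin N))
    (inputState s.state.mat)

/-- `p_{e|xy}`. -/
def pe (f : BasisFun n) (xy : Bits n × Bits n) : ℝ :=
  s.split.errorProb (s.finalState xy) (s.povmA xy) (s.povmB xy) (f xy)

/-- `p_{t|xy}`. -/
def pt (xy : Bits n × Bits n) : ℝ :=
  s.split.transProb (s.finalState xy) (s.povmA xy) (s.povmB xy)

/-- The matching condition for the inputs `(x, y)`. -/
def MatchingAt (xy : Bits n × Bits n) : Prop :=
  s.split.Matching (s.finalState xy) (s.povmA xy) (s.povmB xy)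

/-- The four classes of input pairs: low error (`p_e ≤ e`) or high error, combined with
high transmission (`t ≤ p_t`) or low transmission, always with the matching condition. -/
def inputClass (f : BasisFun n) (e t : ℝ) : Fin 4 → Set (Bits n × Bits n) :=
  ![{xy | s.pe f xy ≤ e ∧ t ≤ s.pt xy ∧ s.MatchingAt xy},
    {xy | s.pe f xy ≤ e ∧ s.pt xy < t ∧ s.MatchingAt xy},
    {xy | e < s.pe f xy ∧ t ≤ s.pt xy ∧ s.MatchingAt xy},
    {xy | e < s.pe f xy ∧ s.pt xy < t ∧ s.MatchingAt xy}]

end SubStrategy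

/-- A `q`-qubit strategy: a sub-strategy for every value `r` of a discrete shared random variable
with distribution `p`. -/
structure Strategy (n q : ℕ) where
  R : Type
  p : R → ℝ
  p_nonneg : ∀ r, 0 ≤ p r
  p_hasSum : HasSum p 1
  sub : R → SubStrategy n q

namespace Strategy

variable {n q : ℕ} (S : Strategy n q)

/-- The probability that the verifiers see a wrong bit (for uniformly random `x` and `y`). -/
def errorProb (f : BasisFun n) : ℝ :=
  ∑' r, S.p r * ((∑ xy, (S.sub r).pe f xy) / (2 : ℝ) ^ (2 * n))

/-- The probability of a detection (for uniformly random `x` and `y`). -/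
def transmission : ℝ :=
  ∑' r, S.p r * ((∑ xy, (S.sub r).pt xy) / (2 : ℝ) ^ (2 * n))

/-- `S`, used against the function `f`, is a `({p_r}, ε, η)`-strategy with
`(εthr, ηthr, {l_{1,r}, l_{2,r}, l_{3,r}, l_{4,r}})`-partition: its transmission is `η`, its error
rate conditioned on detection is `ε`, and for each `r` the four classes of input pairs have the
sizes `l_{i,r}` and comprise all `2^{2n}` pairs. -/
structure HasPartition (f : BasisFun n) (ε η εthr ηthr : ℝ) (l : S.R → Fin 4 → ℕ) : Prop where
  transmission_eq : S.transmission = η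
  error_eq : S.errorProb f / S.transmission = ε
  card_eq : ∀ r i, ((S.sub r).inputClass f (εthr * η) ηthr i).ncard = l r i
  sum_eq : ∀ r, ∑ i, l r i = 2 ^ (2 * n)

end Strategy

/-! ### Purified output states and their separation -/

/-- The purifying system `P_A`, of `2(q+1)` qubits. -/
abbrev PurA (q : ℕ) : Type := Qubits (2 * (q + 1))

/-- The purifying system `P_B`, of `2q` qubits. -/
abbrev PurB (q : ℕ) : Type := Qubits (2 * q)

/-- The purifying system `P`, of `2q` qubits. -/
abbrev PurP (q : ℕ) : Type := Qubits (2 * q)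

/-- A (possibly differently indexed) unitary matrix. -/
def IsUnitary {m m' : Type} [Fintype m] [Fintype m'] [DecidableEq m] [DecidableEq m']
    (U : Matrix m' m ℂ) : Prop :=
  U * Uᴴ = 1 ∧ Uᴴ * U = 1

/-- The vector `|Φ⁺⟩_{VQ} ⊗ |ψ⟩_{ABP} ⊗ |0⟩_{P_A} ⊗ |0⟩_{P_B}`, written on
`V((AQ P_A)(B P_B))P`. -/
def pureInput {q : ℕ} (ψ : (Qubits q × Qubits q) × PurP q → ℂ) :
    Fin 2 × (((Qubits q × Fin 2) × PurA q) × (Qubits q × PurB q)) × PurP q → ℂ :=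
  fun i =>
    bell i.1 i.2.1.1.1.2 * ψ ((i.2.1.1.1.1, i.2.1.2.1), i.2.2) *
      (if i.2.1.1.2 = 0 then 1 else 0) * (if i.2.1.2.2 = 0 then 1 else 0)

namespace Split

variable {q : ℕ} (s : Split q)

/-- The output systems together with all purifying systems. -/
abbrev PureFinal : Type := Fin 2 × ((s.AOut × PurA q) × (s.BOut × PurB q)) × PurP q

/-- The vector `(U_{AQP_A} ⊗ U_{BP_B}) (|Φ⁺⟩_{VQ} ⊗ |ψ⟩_{ABP} ⊗ |00⟩_{P_A P_B})`. -/
def pureOutput (U : Matrix (s.AOut × PurA q) ((Qubits q × Fin 2) × PurA q) ℂ)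
    (W : Matrix (s.BOut × PurB q) (Qubits q × PurB q) ℂ)
    (ψ : (Qubits q × Qubits q) × PurP q → ℂ) : s.PureFinal → ℂ :=
  ((1 : Matrix (Fin 2) (Fin 2) ℂ) ⊗ₖ ((U ⊗ₖ W) ⊗ₖ (1 : Matrix (PurP q) (PurP q) ℂ))) *ᵥ
    pureInput ψ

/-- The reduced state `Tr_{P P_A P_B} |Ψ⟩⟨Ψ|`. -/
def reduced (Ψ : s.PureFinal → ℂ) : Matrix s.Final s.Final ℂ :=
  Matrix.of fun i j => ∑ pa : PurA q, ∑ pb : PurB q, ∑ p : PurP q,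
    Ψ (i.1, ((i.2.1, pa), (i.2.2, pb)), p) * star (Ψ (j.1, ((j.2.1, pa), (j.2.2, pb)), p))

/-- The set `S_θ^{e,t}` of purified output states of `q`-qubit strategies for which some
measurements on `A'` and `B'` have error probability at most `e` in the basis `θ`, transmission
probability at least `t`, and no mismatch of the responses. -/
def outputStates (θ : Bool) (e t : ℝ) : Set (s.PureFinal → ℂ) :=
  {Ψ | (∃ U W ψ, IsUnitary U ∧ IsUnitary W ∧ star ψ ⬝ᵥ ψ = 1 ∧ Ψ = s.pureOutput U W ψ) ∧
    ∃ (A : POVM s.ARecv) (B : POVM s.BRecv),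
      s.errorProb (s.reduced Ψ) A B θ ≤ e ∧ t ≤ s.transProb (s.reduced Ψ) A B ∧
        s.Matching (s.reduced Ψ) A B}

end Split

/-- `δ` is a lower bound on the trace distance of states in `S_0^{e,t}` and `S_1^{e,t}`. -/
def SeparatedBy (q : ℕ) (e t δ : ℝ) : Prop :=
  ∀ s : Split q, ∀ Ψ₀ ∈ s.outputStates false e t, ∀ Ψ₁ ∈ s.outputStates true e t,
    δ ≤ traceDist (dyad Ψ₀) (dyad Ψ₁)

/-! ### Binary entropy and uniformly random functions -/

/-- The binary entropy function, with logarithms to base 2. -/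
def hb (x : ℝ) : ℝ := Real.binEntropy x / Real.log 2

/-- The probability that a uniformly random `f : {0,1}^n × {0,1}^n → {0,1}` lies in `E`. -/
def probFun {n : ℕ} (E : Set (BasisFun n)) : ℝ := (E.ncard : ℝ) / Fintype.card (BasisFun n)

/-- The expectation of `X f` for a uniformly random `f : {0,1}^n × {0,1}^n → {0,1}`. -/
def meanFun {n : ℕ} (X : BasisFun n → ℝ) : ℝ := (∑ f, X f) / Fintype.card (BasisFun n)

end QPV

end

noncomputable section

namespace QPV

/-! This is a counting argument. Purifying a sub-strategy makes its output a pure vector determined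
by a shared state, one unitary per `x` and one unitary per `y`. If Alice and Bob do well at `(x,
y)`, that vector lies in the set belonging to the basis `f(x, y)`. The two sets are `δ`-separated,
so the basis survives a perturbation of the vector by less than `δ / 2`. Replacing state and
unitaries by points of finite nets therefore produces a function `g` that agrees with `f` on all
good inputs.

For each splitting, the number of possible `g` is exponential only in about `2^(6q+n)`, which `q ≤
n/6 - q₀` keeps to a small multiple of `2^(2n)` (`exists_rounding`, `rounding_size_le`). If more
than a fraction `1 - ν` of the inputs is good, `f` lies in a Hamming ball of relative radius `ν`
about some `g`. Such a ball has at most `2^(2^(2n) h_b(ν))` points (`card_hammingBall_le`). The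
equation for `ν` makes the union of all these balls a fraction at most `2^(-α)` of all functions
(`probFun_attackable_le`).

For the other `f`, every sub-strategy has many inputs of high error or low transmission. A linear
inequality at each input, averaged over inputs and shared randomness, turns this into the bound on
the error rate (`HasPartition.le_error`). The exceptional set depends on `f` alone, so the strategy
may be chosen after `f`. -/

/-! ### Volume of Hamming balls -/

open Finset in
-- These are the probabilities of `f` when each value of `g` is flipped independently with
-- probability `ν`; expand `∏ (ν + (1 - ν))`.
lemma sum_bernoulli_weights {X : Type*} [Fintype X] [DecidableEq X] (g : X → Bool) (ν : ℝ) :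
    ∑ f : X → Bool, ν ^ #{x | f x ≠ g x} * (1 - ν) ^ (Fintype.card X - #{x | f x ≠ g x}) = 1 := by
  have h := Finset.prod_univ_sum (fun _ : X => (univ : Finset Bool))
    (fun x b => if b ≠ g x then ν else 1 - ν)
  have h1 : ∀ x, ∑ b : Bool, (if b ≠ g x then ν else 1 - ν) = 1 := by
    intro x
    cases g x <;> simp
  rw [Finset.prod_congr rfl fun x _ => h1 x, Finset.prod_const_one, Fintype.piFinset_univ] at h
  refine Eq.trans (Finset.sum_congr rfl fun f _ => ?_) h.symm
  rw [Finset.prod_ite, Finset.prod_const, Finset.prod_const]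
  congr 2
  rw [← Finset.card_univ, ← Finset.card_filter_add_card_filter_not (s := univ)
    (fun x => f x ≠ g x)]
  simp

lemma two_rpow_mul_hb (N ν : ℝ) : (2 : ℝ) ^ (N * hb ν) = Real.exp (N * Real.binEntropy ν) := by
  rw [Real.rpow_def_of_pos two_pos, hb]
  congr 1
  have := (Real.log_pos one_lt_two).ne'
  field_simp

/-- The logarithm of the weight is affine in `d` with slope `log ν - log (1 - ν) ≤ 0`, and equals
the left exponent at `d = ν N`. So every point of the ball has at least this weight. -/
lemma exp_neg_binEntropy_le {ν : ℝ} (hν₀ : 0 < ν) (hν₁ : ν ≤ 1 / 2) {N d : ℕ} (hd : d ≤ N)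
    (h : (d : ℝ) ≤ ν * N) :
    Real.exp (-(N * Real.binEntropy ν)) ≤ ν ^ d * (1 - ν) ^ (N - d) := by
  have h1 : 0 < 1 - ν := by linarith
  rw [← Real.exp_log (pow_pos hν₀ d), ← Real.exp_log (pow_pos h1 (N - d)), ← Real.exp_add,
    Real.exp_le_exp, Real.log_pow, Real.log_pow, Nat.cast_sub hd, Real.binEntropy,
    Real.log_inv, Real.log_inv]
  have h2 : Real.log ν ≤ Real.log (1 - ν) := Real.log_le_log hν₀ (by linarith)
  nlinarith [mul_nonneg (sub_nonneg.2 h) (sub_nonneg.2 h2)]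

open Finset in
/-- The Chernoff bound for the volume of a Hamming ball. -/
lemma card_hammingBall_le {X : Type*} [Fintype X] [DecidableEq X] (g : X → Bool) {ν : ℝ}
    (hν₀ : 0 ≤ ν) (hν₁ : ν ≤ 1 / 2) :
    (#{f : X → Bool | (#{x | f x ≠ g x} : ℝ) < ν * Fintype.card X} : ℝ) ≤
      (2 : ℝ) ^ (Fintype.card X * hb ν) := by
  rcases hν₀.eq_or_lt with rfl | hν
  · have : (univ.filter fun f : X → Bool =>
        (#{x | f x ≠ g x} : ℝ) < 0 * Fintype.card X) = ∅ := by
      refine Finset.filter_false_of_mem fun f _ => ?_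
      rw [zero_mul, not_lt]
      positivity
    rw [this]
    simp only [Finset.card_empty, Nat.cast_zero]
    positivity
  have h1 : 0 < 1 - ν := by linarith
  rw [two_rpow_mul_hb]
  set c := Real.exp (-(Fintype.card X * Real.binEntropy ν)) with hc
  have key : (#{f : X → Bool | (#{x | f x ≠ g x} : ℝ) < ν * Fintype.card X} : ℝ) * c ≤ 1 := by
    rw [← sum_bernoulli_weights g ν, ← nsmul_eq_mul, ← Finset.sum_const]
    refine (Finset.sum_le_sum fun f hf => ?_).trans
      (Finset.sum_le_sum_of_subset_of_nonneg (Finset.filter_subset _ _) fun f _ _ => ?_)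
    · exact exp_neg_binEntropy_le hν hν₁ (Finset.card_le_univ _) (Finset.mem_filter.1 hf).2.le
    · positivity
  have hpos : 0 < Real.exp (Fintype.card X * Real.binEntropy ν) := Real.exp_pos _
  rw [hc, Real.exp_neg, ← div_eq_mul_inv, div_le_one hpos] at key
  exact key

/-! ### Nets in the unit ball -/

open MeasureTheory Metric Module in
/-- The volumetric bound for `ε`-separated subsets of the unit ball. -/
lemma card_le_of_separated {E : Type*} [NormedAddCommGroup E] [NormedSpace ℝ E]
    [FiniteDimensional ℝ E] {ε : ℝ} (hε : 0 < ε) (s : Finset E) (hs : ∀ c ∈ s, ‖c‖ ≤ 1)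
    (h : ∀ c ∈ s, ∀ d ∈ s, c ≠ d → ε ≤ ‖c - d‖) :
    (s.card : ℝ) ≤ (1 + 2 / ε) ^ finrank ℝ E := by
  borelize E
  let μ : Measure E := Measure.addHaar
  have δpos : 0 < ε / 2 := by linarith
  have ρpos : 0 < 1 + ε / 2 := by linarith
  -- Balls of radius `ε / 2` about the points are disjoint and lie in the ball of radius `1 + ε /
  -- 2`; compare Haar measures.
  set A := ⋃ c ∈ s, ball (c : E) (ε / 2) with hA
  have D : Set.Pairwise (s : Set E) (Function.onFun Disjoint fun c => ball (c : E) (ε / 2)) := by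
    rintro c hc d hd hcd
    apply ball_disjoint_ball
    rw [dist_eq_norm, add_halves]
    exact h c hc d hd hcd
  have A_subset : A ⊆ ball (0 : E) (1 + ε / 2) := by
    refine Set.iUnion₂_subset fun x hx => ball_subset_ball' ?_
    rw [dist_zero_right]
    linarith [hs x hx]
  have I : (s.card : ENNReal) * ENNReal.ofReal ((ε / 2) ^ finrank ℝ E) * μ (ball 0 1) ≤
      ENNReal.ofReal ((1 + ε / 2) ^ finrank ℝ E) * μ (ball 0 1) :=
    calc
      _ = μ A := by
        rw [hA, measure_biUnion_finset D fun c _ => measurableSet_ball]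
        simp only [μ.addHaar_ball_of_pos _ δpos, Finset.sum_const, nsmul_eq_mul, mul_assoc]
      _ ≤ μ (ball (0 : E) (1 + ε / 2)) := measure_mono A_subset
      _ = _ := by simp only [μ.addHaar_ball_of_pos _ ρpos]
  have J := (ENNReal.mul_le_mul_iff_left (measure_ball_pos μ (0 : E) zero_lt_one).ne'
    measure_ball_lt_top.ne).1 I
  have K : (s.card : ℝ) * (ε / 2) ^ finrank ℝ E ≤ (1 + ε / 2) ^ finrank ℝ E := by
    have := ENNReal.toReal_le_of_le_ofReal (pow_nonneg ρpos.le _) J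
    rwa [ENNReal.toReal_mul, ENNReal.toReal_natCast,
      ENNReal.toReal_ofReal (pow_nonneg δpos.le _)] at this
  rw [show 1 + 2 / ε = (1 + ε / 2) / (ε / 2) by field_simp; ring, div_pow,
    le_div_iff₀ (pow_pos δpos _)]
  exact K

open Module in
/-- Subsets of the unit ball have small `ε`-nets. -/
lemma exists_finset_net {E : Type*} [NormedAddCommGroup E] [NormedSpace ℝ E]
    [FiniteDimensional ℝ E] {ε : ℝ} (hε : 0 < ε) (A : Set E) (hA : ∀ c ∈ A, ‖c‖ ≤ 1) :
    ∃ s : Finset E, (∀ c ∈ s, c ∈ A) ∧ (s.card : ℝ) ≤ (1 + 2 / ε) ^ finrank ℝ E ∧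
      ∀ a ∈ A, ∃ c ∈ s, ‖a - c‖ < ε := by
  classical
  -- A separated subset of maximal size is a net, since a point far from all of it could be added.
  -- Its points lie in `A` itself, so nets of unitaries consist of unitaries.
  let P : ℕ → Prop := fun k => ∃ s : Finset E, (∀ c ∈ s, c ∈ A) ∧
    (∀ c ∈ s, ∀ d ∈ s, c ≠ d → ε ≤ ‖c - d‖) ∧ s.card = k
  have hbound : ∀ k, P k → k ≤ ⌊(1 + 2 / ε) ^ finrank ℝ E⌋₊ := by
    rintro k ⟨s, hs, h, rfl⟩
    exact Nat.le_floor (card_le_of_separated hε s (fun c hc => hA c (hs c hc)) h)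
  have hP0 : P 0 := ⟨∅, by simp⟩
  obtain ⟨s, hs, hsep, hcard⟩ := Nat.findGreatest_spec (hbound 0 hP0) hP0
  refine ⟨s, hs, card_le_of_separated hε s (fun c hc => hA c (hs c hc)) hsep, fun a ha => ?_⟩
  by_contra! hcon
  have has : a ∉ s := fun h => by
    have := hcon a h
    simp only [sub_self, norm_zero] at this
    linarith
  have hP : P (s.card + 1) := by
    refine ⟨insert a s, ?_, ?_, Finset.card_insert_of_notMem has⟩
    · simpa [ha] using hs
    · intro c hc d hd hcd
      rcases Finset.mem_insert.1 hc with rfl | hc' <;> rcases Finset.mem_insert.1 hd with rfl | hd'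
      · exact absurd rfl hcd
      · exact hcon d hd'
      · rw [norm_sub_rev]
        exact hcon c hc'
      · exact hsep c hc' d hd' hcd
  have := Nat.le_findGreatest (hbound _ hP) hP
  omega

/-! ### Trace distance of pure states and operator norms -/

section NormBounds

open scoped Matrix.Norms.L2Operator

lemma norm_toLp_sq {ι : Type*} [Fintype ι] (v : ι → ℂ) :
    ‖WithLp.toLp 2 v‖ ^ 2 = (star v ⬝ᵥ v).re := by
  rw [EuclideanSpace.norm_sq_eq, dotProduct, Complex.re_sum]
  refine Finset.sum_congr rfl fun i _ => ?_
  simp only [Pi.star_apply, RCLike.star_def, Complex.conj_mul', ← Complex.ofReal_pow,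
    Complex.ofReal_re]

lemma norm_toLp_eq_one {ι : Type*} [Fintype ι] {v : ι → ℂ} (hv : star v ⬝ᵥ v = 1) :
    ‖WithLp.toLp 2 v‖ = 1 := by
  have h := norm_toLp_sq v
  rw [hv, Complex.one_re] at h
  exact (pow_eq_one_iff_of_nonneg (norm_nonneg _) two_ne_zero).1 h

lemma trace_dyad_mul_dyad {ι : Type} [Fintype ι] (v w : ι → ℂ) :
    (dyad v * dyad w).trace = (star v ⬝ᵥ w) * (star w ⬝ᵥ v) := by
  rw [dyad, dyad, Matrix.vecMulVec_mul_vecMulVec, Matrix.trace_vecMulVec, dotProduct_smul,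
    smul_eq_mul, dotProduct_comm v]

lemma conjTranspose_dyad {ι : Type} (v : ι → ℂ) : (dyad v)ᴴ = dyad v := by
  rw [dyad, Matrix.conjTranspose_vecMulVec, star_star]

lemma rank_dyad_sub_dyad_le {ι : Type} [Fintype ι] (v w : ι → ℂ) :
    (dyad v - dyad w).rank ≤ 2 := by
  have h : dyad v - dyad w = Matrix.vecMulVec v (star v) + Matrix.vecMulVec (-w) (star w) := by
    rw [Matrix.neg_vecMulVec, sub_eq_add_neg, dyad, dyad]
  rw [h]
  have h1 := Matrix.rank_vecMulVec_le v (star v)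
  have h2 := Matrix.rank_vecMulVec_le (-w) (star w)
  rw [Matrix.rank] at h1 h2 ⊢
  rw [Matrix.mulVecLin_add]
  refine (Submodule.finrank_mono (LinearMap.range_add_le _ _)).trans ?_
  exact (Submodule.finrank_add_le_finrank_add_finrank _ _).trans (add_le_add h1 h2)

/-- Cauchy–Schwarz over the nonzero singular values, of which there are `M.rank`. -/
lemma traceNorm_sq_le {ι : Type} [Fintype ι] [DecidableEq ι] (M : Matrix ι ι ℂ) :
    traceNorm M ^ 2 ≤ M.rank * (Mᴴ * M).trace.re := by
  set hH := Matrix.isHermitian_conjTranspose_mul_self M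
  have hpos : ∀ i, 0 ≤ hH.eigenvalues i :=
    (Matrix.posSemidef_conjTranspose_mul_self M).eigenvalues_nonneg
  have htr : (Mᴴ * M).trace.re = ∑ i, hH.eigenvalues i := by
    rw [hH.trace_eq_sum_eigenvalues, Complex.re_sum]
    rfl
  have hrank : M.rank = (Finset.univ.filter fun i => hH.eigenvalues i ≠ 0).card := by
    rw [← Matrix.rank_conjTranspose_mul_self M, hH.rank_eq_card_non_zero_eigs,
      Fintype.card_subtype]
  have hsum : traceNorm M =
      ∑ i ∈ Finset.univ.filter fun i => hH.eigenvalues i ≠ 0, Real.sqrt (hH.eigenvalues i) := by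
    rw [traceNorm, Finset.sum_filter_of_ne]
    intro i _ h h0
    rw [h0, Real.sqrt_zero] at h
    exact h rfl
  rw [hsum, hrank, htr]
  refine sq_sum_le_card_mul_sum_sq.trans (mul_le_mul_of_nonneg_left ?_ (Nat.cast_nonneg _))
  simp only [fun i => Real.sq_sqrt (hpos i)]
  exact Finset.sum_le_sum_of_subset_of_nonneg (Finset.filter_subset _ _) fun i _ _ => hpos i

/-- With `c = ⟨v, w⟩`, the difference has rank at most 2 and squared Hilbert–Schmidt norm `2 -
2|c|²`, so the squared trace distance is at most `1 - |c|² ≤ 1 - (Re c)²`. This is at most `‖v - w‖²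
= 2 - 2 Re c` because `(1 - Re c)² ≥ 0`. -/
lemma traceDist_dyad_le {ι : Type} [Fintype ι] [DecidableEq ι] {v w : ι → ℂ}
    (hv : star v ⬝ᵥ v = 1) (hw : star w ⬝ᵥ w = 1) :
    traceDist (dyad v) (dyad w) ≤ ‖WithLp.toLp 2 (v - w)‖ := by
  set c := star v ⬝ᵥ w with hc
  have hc' : star w ⬝ᵥ v = star c := by
    rw [hc, Matrix.star_dotProduct]
  have htr : ((dyad v - dyad w)ᴴ * (dyad v - dyad w)).trace.re = 2 - 2 * ‖c‖ ^ 2 := by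
    rw [Matrix.conjTranspose_sub, conjTranspose_dyad, conjTranspose_dyad, sub_mul, mul_sub,
      mul_sub, Matrix.trace_sub, Matrix.trace_sub, Matrix.trace_sub, trace_dyad_mul_dyad,
      trace_dyad_mul_dyad, trace_dyad_mul_dyad, trace_dyad_mul_dyad, hv, hw, ← hc, hc',
      mul_comm (star c) c]
    simp only [RCLike.star_def, Complex.mul_conj', ← Complex.ofReal_pow, Complex.sub_re,
      Complex.ofReal_re, Complex.mul_re, Complex.one_re, Complex.one_im]
    ring
  have hn : ‖WithLp.toLp 2 (v - w)‖ ^ 2 = 2 - 2 * c.re := by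
    rw [norm_toLp_sq, star_sub, sub_dotProduct, dotProduct_sub, dotProduct_sub, hv, hw, ← hc, hc']
    simp only [RCLike.star_def, Complex.sub_re, Complex.one_re, Complex.conj_re]
    ring
  have h1 := traceNorm_sq_le (dyad v - dyad w)
  rw [htr] at h1
  have h2 : ((dyad v - dyad w).rank : ℝ) ≤ 2 := by exact_mod_cast rank_dyad_sub_dyad_le v w
  have h3 : c.re ^ 2 ≤ ‖c‖ ^ 2 := by
    rw [← Complex.normSq_eq_norm_sq, Complex.normSq_apply]
    nlinarith [mul_self_nonneg c.im]
  have h5 : 0 ≤ 2 - 2 * ‖c‖ ^ 2 := by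
    rw [← htr, Matrix.conjTranspose_sub, conjTranspose_dyad, conjTranspose_dyad]
    have := (Matrix.posSemidef_conjTranspose_mul_self (dyad v - dyad w)).trace_nonneg
    rw [Matrix.conjTranspose_sub, conjTranspose_dyad, conjTranspose_dyad] at this
    exact (Complex.nonneg_iff.1 this).1
  have h4 := mul_le_mul_of_nonneg_right h2 h5
  refine abs_le_of_sq_le_sq' ?_ (norm_nonneg _) |>.2
  rw [traceDist, hn, div_pow]
  nlinarith [sq_nonneg (1 - c.re)]

variable {m m' n n' : Type*} [Fintype m] [Fintype m'] [Fintype n] [Fintype n']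
  [DecidableEq m] [DecidableEq n]

lemma l2_opNorm_le_of_forall {A : Matrix m' m ℂ} {C : ℝ} (hC : 0 ≤ C)
    (h : ∀ v : m → ℂ, ‖WithLp.toLp 2 (A *ᵥ v)‖ ^ 2 ≤ C ^ 2 * ‖WithLp.toLp 2 v‖ ^ 2) :
    ‖A‖ ≤ C := by
  rw [Matrix.l2_opNorm_def]
  refine ContinuousLinearMap.opNorm_le_bound _ hC fun x => ?_
  have := h x.ofLp
  rw [← mul_pow] at this
  exact abs_le_of_sq_le_sq' this (by positivity) |>.2

lemma norm_mulVec_sq_le (A : Matrix m' m ℂ) (v : m → ℂ) :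
    ‖WithLp.toLp 2 (A *ᵥ v)‖ ^ 2 ≤ ‖A‖ ^ 2 * ‖WithLp.toLp 2 v‖ ^ 2 := by
  rw [← mul_pow]
  exact pow_le_pow_left₀ (norm_nonneg _) (Matrix.l2_opNorm_mulVec A (WithLp.toLp 2 v)) 2

lemma l2_opNorm_one_kronecker_le (A : Matrix m' m ℂ) : ‖(1 : Matrix n n ℂ) ⊗ₖ A‖ ≤ ‖A‖ := by
  refine l2_opNorm_le_of_forall (norm_nonneg _) fun v => ?_
  have h : ∀ i j, ((1 : Matrix n n ℂ) ⊗ₖ A *ᵥ v) (i, j) = (A *ᵥ fun k => v (i, k)) j := by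
    intro i j
    simp [Matrix.mulVec, dotProduct, Fintype.sum_prod_type, Matrix.one_apply]
  simp only [EuclideanSpace.norm_sq_eq, Fintype.sum_prod_type, h,
    Finset.mul_sum (s := Finset.univ (α := n))]
  refine Finset.sum_le_sum fun i _ => ?_
  simpa only [EuclideanSpace.norm_sq_eq] using norm_mulVec_sq_le A fun k => v (i, k)

lemma l2_opNorm_kronecker_one_le (A : Matrix m' m ℂ) : ‖A ⊗ₖ (1 : Matrix n n ℂ)‖ ≤ ‖A‖ := by
  refine l2_opNorm_le_of_forall (norm_nonneg _) fun v => ?_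
  have h : ∀ i j, (A ⊗ₖ (1 : Matrix n n ℂ) *ᵥ v) (j, i) = (A *ᵥ fun k => v (k, i)) j := by
    intro i j
    simp [Matrix.mulVec, dotProduct, Fintype.sum_prod_type, Matrix.one_apply]
  simp only [EuclideanSpace.norm_sq_eq, Fintype.sum_prod_type_right, h,
    Finset.mul_sum (s := Finset.univ (α := n))]
  refine Finset.sum_le_sum fun i _ => ?_
  simpa only [EuclideanSpace.norm_sq_eq] using norm_mulVec_sq_le A fun k => v (k, i)

lemma l2_opNorm_kronecker_le [DecidableEq n'] (A : Matrix m' m ℂ) (B : Matrix n' n ℂ) :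
    ‖A ⊗ₖ B‖ ≤ ‖A‖ * ‖B‖ := by
  have h : A ⊗ₖ B = (A ⊗ₖ (1 : Matrix n' n' ℂ)) * ((1 : Matrix m m ℂ) ⊗ₖ B) := by
    rw [← Matrix.mul_kronecker_mul, Matrix.mul_one, Matrix.one_mul]
  rw [h]
  exact (Matrix.l2_opNorm_mul _ _).trans (mul_le_mul (l2_opNorm_kronecker_one_le A)
    (l2_opNorm_one_kronecker_le B) (norm_nonneg _) (norm_nonneg _))

lemma l2_opNorm_le_one_of_conjTranspose_mul_self {A : Matrix m' m ℂ} (h : Aᴴ * A = 1) :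
    ‖A‖ ≤ 1 := by
  refine l2_opNorm_le_of_forall zero_le_one fun v => ?_
  rw [norm_toLp_sq, norm_toLp_sq, Matrix.star_mulVec, ← Matrix.dotProduct_mulVec,
    Matrix.mulVec_mulVec, h, Matrix.one_mulVec, one_pow, one_mul]

end NormBounds

/-! ### Lipschitz dependence of the output vector on the unitaries and the state -/

section Lipschitz

open scoped Matrix.Norms.L2Operator

variable {q : ℕ}

lemma sum_bell_sq : ∑ i, ∑ j, ‖bell i j‖ ^ 2 = 1 := by
  simp [bell, Fin.sum_univ_two]
  norm_num

lemma norm_pureInput_sq (ψ : (Qubits q × Qubits q) × PurP q → ℂ) :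
    ‖WithLp.toLp 2 (pureInput ψ)‖ ^ 2 = ‖WithLp.toLp 2 ψ‖ ^ 2 := by
  have h : ∀ v c pa b pb p, ‖pureInput ψ (v, (((c, pa), (b, pb)), p))‖ ^ 2 =
      (if pa = 0 then (if pb = 0 then ‖bell v c.2‖ ^ 2 * ‖ψ ((c.1, b), p)‖ ^ 2 else 0) else 0) := by
    intro v c pa b pb p
    simp only [pureInput, norm_mul, mul_pow]
    split_ifs <;> simp
  simp only [EuclideanSpace.norm_sq_eq, Fintype.sum_prod_type, h, Finset.sum_ite_irrel,
    Finset.sum_ite_eq', Finset.sum_const_zero, Finset.mem_univ, if_true]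
  simp only [← Finset.mul_sum]
  calc _ = (∑ i, ∑ j, ‖bell i j‖ ^ 2) * ∑ a, ∑ b, ∑ p, ‖ψ ((a, b), p)‖ ^ 2 := by
        rw [Finset.sum_mul]
        refine Finset.sum_congr rfl fun v _ => ?_
        rw [Finset.sum_comm, Finset.sum_mul]
        exact Finset.sum_congr rfl fun c _ => (Finset.mul_sum _ _ _).symm
    _ = _ := by rw [sum_bell_sq, one_mul]

lemma norm_pureInput (ψ : (Qubits q × Qubits q) × PurP q → ℂ) :
    ‖WithLp.toLp 2 (pureInput ψ)‖ = ‖WithLp.toLp 2 ψ‖ :=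
  (sq_eq_sq₀ (norm_nonneg _) (norm_nonneg _)).1 (norm_pureInput_sq ψ)

lemma pureInput_sub (ψ φ : (Qubits q × Qubits q) × PurP q → ℂ) :
    pureInput (ψ - φ) = pureInput ψ - pureInput φ := by
  ext i
  simp only [pureInput, Pi.sub_apply]
  ring

variable (s : Split q)

lemma norm_pureOutput_le (U : Matrix (s.AOut × PurA q) ((Qubits q × Fin 2) × PurA q) ℂ)
    (W : Matrix (s.BOut × PurB q) (Qubits q × PurB q) ℂ)
    (ψ : (Qubits q × Qubits q) × PurP q → ℂ) :
    ‖WithLp.toLp 2 (s.pureOutput U W ψ)‖ ≤ ‖U‖ * ‖W‖ * ‖WithLp.toLp 2 ψ‖ := by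
  refine (Matrix.l2_opNorm_mulVec _ (WithLp.toLp 2 (pureInput ψ))).trans ?_
  rw [norm_pureInput]
  refine mul_le_mul_of_nonneg_right ?_ (norm_nonneg _)
  exact (l2_opNorm_one_kronecker_le _).trans
    ((l2_opNorm_kronecker_one_le _).trans (l2_opNorm_kronecker_le U W))

/-- Telescoping: one of the three arguments is exchanged at a time, so each error is measured
separately. -/
lemma pureOutput_sub (U U' : Matrix (s.AOut × PurA q) ((Qubits q × Fin 2) × PurA q) ℂ)
    (W W' : Matrix (s.BOut × PurB q) (Qubits q × PurB q) ℂ)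
    (ψ ψ' : (Qubits q × Qubits q) × PurP q → ℂ) :
    s.pureOutput U W ψ - s.pureOutput U' W' ψ' = s.pureOutput (U - U') W ψ +
      s.pureOutput U' (W - W') ψ + s.pureOutput U' W' (ψ - ψ') := by
  have h1 : (U - U') ⊗ₖ W = U ⊗ₖ W - U' ⊗ₖ W := by
    ext; simp [sub_mul]
  have h2 : U' ⊗ₖ (W - W') = U' ⊗ₖ W - U' ⊗ₖ W' := by
    ext; simp [mul_sub]
  have h3 : ∀ (X Y : Matrix ((s.AOut × PurA q) × (s.BOut × PurB q))
      (((Qubits q × Fin 2) × PurA q) × (Qubits q × PurB q)) ℂ),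
      (1 : Matrix (Fin 2) (Fin 2) ℂ) ⊗ₖ ((X - Y) ⊗ₖ (1 : Matrix (PurP q) (PurP q) ℂ)) =
      (1 : Matrix (Fin 2) (Fin 2) ℂ) ⊗ₖ (X ⊗ₖ (1 : Matrix (PurP q) (PurP q) ℂ)) -
      (1 : Matrix (Fin 2) (Fin 2) ℂ) ⊗ₖ (Y ⊗ₖ (1 : Matrix (PurP q) (PurP q) ℂ)) := by
    intro X Y
    ext; simp [mul_sub, sub_mul]
  simp only [Split.pureOutput, h1, h2, h3, pureInput_sub, Matrix.sub_mulVec, Matrix.mulVec_sub]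
  abel

lemma norm_pureOutput_sub_le
    {U U' : Matrix (s.AOut × PurA q) ((Qubits q × Fin 2) × PurA q) ℂ}
    {W W' : Matrix (s.BOut × PurB q) (Qubits q × PurB q) ℂ}
    {ψ ψ' : (Qubits q × Qubits q) × PurP q → ℂ}
    (hU' : IsUnitary U') (hW : IsUnitary W) (hW' : IsUnitary W') (hψ : star ψ ⬝ᵥ ψ = 1) :
    ‖WithLp.toLp 2 (s.pureOutput U W ψ - s.pureOutput U' W' ψ')‖ ≤
      ‖U - U'‖ + ‖W - W'‖ + ‖WithLp.toLp 2 (ψ - ψ')‖ := by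
  have hU1 := l2_opNorm_le_one_of_conjTranspose_mul_self hU'.2
  have hW1 := l2_opNorm_le_one_of_conjTranspose_mul_self hW.2
  have hW1' := l2_opNorm_le_one_of_conjTranspose_mul_self hW'.2
  rw [pureOutput_sub, WithLp.toLp_add, WithLp.toLp_add]
  refine (norm_add₃_le).trans (add_le_add_three ?_ ?_ ?_)
  · refine (norm_pureOutput_le s _ _ _).trans ?_
    rw [norm_toLp_eq_one hψ, mul_one]
    exact mul_le_of_le_one_right (norm_nonneg _) hW1
  · refine (norm_pureOutput_le s _ _ _).trans ?_
    rw [norm_toLp_eq_one hψ, mul_one]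
    exact mul_le_of_le_one_left (norm_nonneg _) hU1
  · exact (norm_pureOutput_le s _ _ _).trans
      (mul_le_of_le_one_left (norm_nonneg _) (mul_le_one₀ hU1 (norm_nonneg _) hW1'))

lemma star_dotProduct_pureOutput
    {U : Matrix (s.AOut × PurA q) ((Qubits q × Fin 2) × PurA q) ℂ}
    {W : Matrix (s.BOut × PurB q) (Qubits q × PurB q) ℂ}
    {ψ : (Qubits q × Qubits q) × PurP q → ℂ}
    (hU : IsUnitary U) (hW : IsUnitary W) (hψ : star ψ ⬝ᵥ ψ = 1) :
    star (s.pureOutput U W ψ) ⬝ᵥ s.pureOutput U W ψ = 1 := by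
  rw [Split.pureOutput, Matrix.star_mulVec, ← Matrix.dotProduct_mulVec, Matrix.mulVec_mulVec]
  simp only [Matrix.conjTranspose_kronecker, ← Matrix.mul_kronecker_mul, hU.2, hW.2,
    Matrix.conjTranspose_one, Matrix.one_mul, Matrix.one_kronecker_one, Matrix.one_mulVec]
  have him : (star (pureInput ψ) ⬝ᵥ pureInput ψ).im = 0 :=
    (Complex.nonneg_iff.1 (dotProduct_star_self_nonneg _)).2.symm
  apply Complex.ext
  · rw [← norm_toLp_sq, norm_pureInput_sq, norm_toLp_sq, hψ]
  · rw [him, Complex.one_im]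

end Lipschitz

/-! ### Purification of states and dilation of channels -/

open scoped MatrixOrder in
lemma exists_vectors_of_posSemidef {ι κ : Type*} [Fintype ι] [Fintype κ] {M : Matrix ι ι ℂ}
    (hM : M.PosSemidef) (e : κ ≃ ι) :
    ∃ v : κ → ι → ℂ, ∀ i j, M i j = ∑ k, v k i * star (v k j) := by
  classical
  obtain ⟨B, hB⟩ := CStarAlgebra.nonneg_iff_eq_star_mul_self.mp hM.nonneg
  refine ⟨fun k i => star (B (e k) i), fun i j => ?_⟩
  rw [hB, Matrix.star_eq_conjTranspose, Matrix.mul_apply, ← e.sum_comp]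
  simp

/-- Choi's argument: the channel applied to half of the unnormalised maximally entangled vector
gives a positive matrix, and the vectors of a rank-one decomposition, reshaped, are Kraus operators.
Trace preservation on matrix units is their completeness relation. -/
lemma Channel.exists_kraus {m m' κ : Type} [Fintype m] [Fintype m'] [Fintype κ] [DecidableEq m]
    (Φ : Channel m m') (hκ : Fintype.card κ = Fintype.card m * Fintype.card m') :
    ∃ K : κ → m' → m → ℂ,
      (∀ N i j, Φ.toLin N i j = ∑ k, ∑ a, ∑ b, K k i a * N a b * star (K k j b)) ∧
      ∀ a b, ∑ k, ∑ i, K k i a * star (K k i b) = if a = b then 1 else 0 := by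
  classical
  let e := Fintype.equivFin m
  let v : Fin (Fintype.card m) × m → ℂ := fun p => if e p.2 = p.1 then 1 else 0
  have hchoi := Φ.completelyPositive _ _ (Matrix.posSemidef_vecMulVec_self_star v)
  obtain ⟨w, hw⟩ := exists_vectors_of_posSemidef hchoi
    (Fintype.equivOfCardEq (by simp [hκ]) : κ ≃ Fin (Fintype.card m) × m')
  have hsingle : ∀ a b i j, Φ.toLin (Matrix.single a b 1) i j =
      ∑ k, w k (e a, i) * star (w k (e b, j)) := by
    intro a b i j
    rw [← hw]
    simp only [mapSnd, Matrix.of_apply]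
    refine congrFun (congrFun (congrArg Φ.toLin ?_) i) j
    ext x y
    simp [Matrix.vecMulVec_apply, v, Matrix.single_apply, eq_comm, ← ite_and]
    exact if_congr and_comm rfl rfl
  refine ⟨fun k i a => w k (e a, i), fun N i j => ?_, fun a b => ?_⟩
  · conv_lhs => rw [Matrix.matrix_eq_sum_single N]
    simp only [map_sum, Matrix.sum_apply]
    rw [Finset.sum_comm' (s := Finset.univ (α := κ)) (t' := Finset.univ)
      (s' := fun _ => Finset.univ) (by simp)]
    refine Finset.sum_congr rfl fun a _ => ?_
    rw [Finset.sum_comm]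
    refine Finset.sum_congr rfl fun b _ => ?_
    have : Matrix.single a b (N a b) = N a b • Matrix.single a b (1 : ℂ) := by
      rw [Matrix.smul_single, smul_eq_mul, mul_one]
    rw [this, map_smul, Matrix.smul_apply, hsingle, smul_eq_mul, Finset.mul_sum]
    exact Finset.sum_congr rfl fun k _ => by ring
  · have h := Φ.tracePreserving (Matrix.single a b 1)
    rw [Matrix.trace] at h
    simp only [Matrix.diag_apply, hsingle] at h
    rw [Finset.sum_comm] at h
    rw [h]
    split_ifs with hab
    · subst hab
      exact Matrix.trace_single_eq_same a 1
    · exact Matrix.trace_single_eq_of_ne _ _ _ hab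

/-- By completeness, the stacked Kraus operators have orthonormal columns. These are the columns of
`U` on ancilla state `k₀`; an orthonormal basis extending them supplies the rest. -/
lemma exists_unitary_extension {m m' κ : Type} [Fintype m] [Fintype m'] [Fintype κ]
    [DecidableEq m] [DecidableEq m'] [DecidableEq κ] (hm : Fintype.card m' = Fintype.card m)
    (k₀ : κ) (K : κ → m' → m → ℂ)
    (hK : ∀ a b, ∑ k, ∑ i, K k i a * star (K k i b) = if a = b then 1 else 0) :
    ∃ U : Matrix (m' × κ) (m × κ) ℂ, IsUnitary U ∧ ∀ i k a, U (i, k) (a, k₀) = K k i a := by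
  let v : m × κ → EuclideanSpace ℂ (m' × κ) := fun p => WithLp.toLp 2 fun r => K r.2 r.1 p.1
  have hv : Orthonormal ℂ (({p : m × κ | p.2 = k₀} : Set (m × κ)).domRestrict v) := by
    rw [orthonormal_iff_ite]
    rintro ⟨⟨a, k⟩, rfl⟩ ⟨⟨b, k'⟩, hk'⟩
    change k' = k at hk'
    subst hk'
    simp only [Set.domRestrict_apply, v, PiLp.inner_apply, RCLike.inner_apply,
      Fintype.sum_prod_type_right]
    refine (hK b a).trans ?_
    simp [eq_comm]
  obtain ⟨b, hb⟩ := hv.exists_orthonormalBasis_extension_of_card_eq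
    (by simp [hm])
  have h1 : (Matrix.of fun r c => b c r : Matrix (m' × κ) (m × κ) ℂ)ᴴ *
      (Matrix.of fun r c => b c r : Matrix (m' × κ) (m × κ) ℂ) = 1 := by
    ext c d
    have := orthonormal_iff_ite.1 b.orthonormal c d
    rw [PiLp.inner_apply] at this
    simp only [RCLike.inner_apply] at this
    simp only [Matrix.mul_apply, Matrix.conjTranspose_apply, Matrix.of_apply, Matrix.one_apply]
    rw [← this]
    exact Finset.sum_congr rfl fun r _ => mul_comm _ _
  refine ⟨_, ⟨(Matrix.mul_eq_one_comm_of_card_eq _ _ _ (by simp [hm])).1 h1, h1⟩, fun i k a => ?_⟩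
  rw [Matrix.of_apply, hb _ rfl]

lemma Channel.exists_dilation {m m' κ : Type} [Fintype m] [Fintype m'] [Fintype κ]
    [DecidableEq m] [DecidableEq m'] [DecidableEq κ] (Φ : Channel m m')
    (hm : Fintype.card m' = Fintype.card m)
    (hκ : Fintype.card κ = Fintype.card m * Fintype.card m') (k₀ : κ) :
    ∃ U : Matrix (m' × κ) (m × κ) ℂ, IsUnitary U ∧ ∀ N i j, Φ.toLin N i j =
      ∑ k, ∑ a, ∑ b, U (i, k) (a, k₀) * N a b * star (U (j, k) (b, k₀)) := by
  obtain ⟨K, hK, hK1⟩ := Φ.exists_kraus hκ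
  obtain ⟨U, hU, hUK⟩ := exists_unitary_extension hm k₀ K hK1
  refine ⟨U, hU, fun N i j => ?_⟩
  simp only [hK, hUK]

lemma DensityMatrix.exists_purification {ι κ : Type} [Fintype ι] [Fintype κ]
    (σ : DensityMatrix ι) (e : κ ≃ ι) :
    ∃ ψ : ι × κ → ℂ, star ψ ⬝ᵥ ψ = 1 ∧
      ∀ i j, σ.mat i j = ∑ k, ψ (i, k) * star (ψ (j, k)) := by
  obtain ⟨v, hv⟩ := exists_vectors_of_posSemidef σ.posSemidef e
  refine ⟨fun p => v p.2 p.1, ?_, hv⟩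
  rw [← σ.trace_eq_one, Matrix.trace, dotProduct, Fintype.sum_prod_type]
  refine Finset.sum_congr rfl fun i _ => ?_
  rw [Matrix.diag_apply, hv]
  exact Finset.sum_congr rfl fun k _ => mul_comm _ _

/-- Pulls a purifying index out of a sandwiched matrix; applied first for Bob's channel, then for
Alice's. -/
lemma sum_sandwich {ι κ : Type*} [Fintype ι] [Fintype κ] (u u' : ι → ℂ) (G G' : κ → ι → ℂ) :
    ∑ a, ∑ b, u a * (∑ k, G k a * star (G' k b)) * star (u' b) =
      ∑ k, (∑ a, u a * G k a) * star (∑ b, u' b * G' k b) := by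
  simp only [star_sum, Finset.sum_mul_sum]
  simp only [Finset.mul_sum, Finset.sum_mul]
  rw [Finset.sum_comm' (s := Finset.univ (α := κ)) (t' := Finset.univ)
    (s' := fun _ => Finset.univ) (by simp)]
  refine Finset.sum_congr rfl fun a _ => ?_
  rw [Finset.sum_comm]
  refine Finset.sum_congr rfl fun b _ => Finset.sum_congr rfl fun k _ => ?_
  rw [star_mul']
  ring

namespace Split

variable {q : ℕ} (s : Split q)

lemma pureOutput_apply (U : Matrix (s.AOut × PurA q) ((Qubits q × Fin 2) × PurA q) ℂ)
    (W : Matrix (s.BOut × PurB q) (Qubits q × PurB q) ℂ)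
    (ψ : (Qubits q × Qubits q) × PurP q → ℂ) (v : Fin 2) (i : s.AOut × PurA q)
    (j : s.BOut × PurB q) (p : PurP q) :
    s.pureOutput U W ψ (v, (i, j), p) =
      ∑ c, U i (c, 0) * ∑ b, W j (b, 0) * (bell v c.2 * ψ ((c.1, b), p)) := by
  have h : s.pureOutput U W ψ (v, (i, j), p) =
      ∑ c, ∑ d, U i c * W j d * pureInput ψ (v, (c, d), p) := by
    rw [Split.pureOutput, Matrix.mulVec, dotProduct, Fintype.sum_prod_type,
      Finset.sum_eq_single v (fun w _ hw => by simp [Matrix.one_apply_ne hw.symm]) (by simp),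
      Fintype.sum_prod_type, Fintype.sum_prod_type]
    refine Finset.sum_congr rfl fun c _ => Finset.sum_congr rfl fun d _ => ?_
    rw [Finset.sum_eq_single p (fun w _ hw => by simp [Matrix.one_apply_ne hw.symm]) (by simp)]
    simp
  rw [h, Fintype.sum_prod_type]
  refine Finset.sum_congr rfl fun c _ => ?_
  rw [Finset.sum_eq_single 0 (fun w _ hw => by simp [pureInput, hw]) (by simp),
    Fintype.sum_prod_type, Finset.mul_sum]
  refine Finset.sum_congr rfl fun b _ => ?_
  rw [Finset.sum_eq_single 0 (fun w _ hw => by simp [pureInput, hw]) (by simp)]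
  simp [pureInput]
  ring

end Split

namespace SubStrategy

variable {n q : ℕ} (s : SubStrategy n q)

/-- The states before the measurements have purifications of the form in `Split.outputStates`. -/
lemma exists_purification :
    ∃ (U : Bits n → Matrix (s.split.AOut × PurA q) ((Qubits q × Fin 2) × PurA q) ℂ)
      (W : Bits n → Matrix (s.split.BOut × PurB q) (Qubits q × PurB q) ℂ)
      (ψ : (Qubits q × Qubits q) × PurP q → ℂ),
      (∀ x, IsUnitary (U x)) ∧ (∀ y, IsUnitary (W y)) ∧ star ψ ⬝ᵥ ψ = 1 ∧
        ∀ xy, s.finalState xy = s.split.reduced (s.split.pureOutput (U xy.1) (W xy.2) ψ) := by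
  have hA : Fintype.card s.split.AOut = Fintype.card (Qubits q × Fin 2) := by
    simp [← pow_add, s.split.alice_eq, pow_succ]
  have hB : Fintype.card s.split.BOut = Fintype.card (Qubits q) := by
    simp [← pow_add, s.split.bob_eq]
  -- An environment of size input times output dimension holds all Kraus operators; this is why
  -- `P_A` and `P_B` have `2(q+1)` and `2q` qubits.
  have hAκ : Fintype.card (PurA q) =
      Fintype.card (Qubits q × Fin 2) * Fintype.card s.split.AOut := by
    rw [hA]
    simp only [Fintype.card_fin, Fintype.card_prod]
    ring
  have hBκ : Fintype.card (PurB q) = Fintype.card (Qubits q) * Fintype.card s.split.BOut := by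
    rw [hB]
    simp only [Fintype.card_fin]
    ring
  choose U hU hUΦ using fun x => (s.chanA x).exists_dilation hA hAκ 0
  choose W hW hWΦ using fun y => (s.chanB y).exists_dilation hB hBκ 0
  obtain ⟨ψ, hψ, hσ⟩ := s.state.exists_purification
    (Fintype.equivOfCardEq (by simp only [Fintype.card_fin, Fintype.card_prod]; ring) :
      PurP q ≃ Qubits q × Qubits q)
  refine ⟨U, W, ψ, hU, hW, hψ, ?_⟩
  rintro ⟨x, y⟩
  ext ⟨v, ao, bo⟩ ⟨v', ao', bo'⟩
  have hin : ∀ c c' b b', inputState s.state.mat (v, (c, b)) (v', (c', b')) =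
      ∑ p, (bell v c.2 * ψ ((c.1, b), p)) * star (bell v' c'.2 * ψ ((c'.1, b'), p)) := by
    intro c c' b b'
    simp only [inputState, Matrix.of_apply, hσ, Finset.mul_sum, star_mul']
    exact Finset.sum_congr rfl fun p _ => by ring
  have hmid : ∀ c c', (s.chanB y).toLin (Matrix.of fun b b' =>
        inputState s.state.mat (v, (c, b)) (v', (c', b'))) bo bo' =
      ∑ k : PurB q × PurP q,
        (∑ b, W y (bo, k.1) (b, 0) * (bell v c.2 * ψ ((c.1, b), k.2))) *
          star (∑ b, W y (bo', k.1) (b, 0) * (bell v' c'.2 * ψ ((c'.1, b), k.2))) := by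
    intro c c'
    rw [hWΦ, Fintype.sum_prod_type]
    simp only [Matrix.of_apply, hin]
    exact Finset.sum_congr rfl fun k _ => sum_sandwich _ _
      (fun p b => bell v c.2 * ψ ((c.1, b), p)) fun p b => bell v' c'.2 * ψ ((c'.1, b), p)
  have hout : s.finalState (x, y) (v, (ao, bo)) (v', (ao', bo')) =
      (s.chanA x).toLin (Matrix.of fun c c' => (s.chanB y).toLin (Matrix.of fun b b' =>
        inputState s.state.mat (v, (c, b)) (v', (c', b'))) bo bo') ao ao' := rfl
  rw [hout, hUΦ]
  refine Finset.sum_congr rfl fun pa _ => ?_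
  simp only [Matrix.of_apply, hmid, Split.pureOutput_apply]
  rw [sum_sandwich, Fintype.sum_prod_type]

end SubStrategy

/-! ### Positivity and bounds of the response probabilities -/

open scoped MatrixOrder in
lemma trace_mul_nonneg {ι : Type*} [Fintype ι] {M ρ : Matrix ι ι ℂ} (hM : M.PosSemidef)
    (hρ : ρ.PosSemidef) : 0 ≤ (M * ρ).trace := by
  classical
  obtain ⟨C, rfl⟩ := CStarAlgebra.nonneg_iff_eq_star_mul_self.mp hM.nonneg
  rw [Matrix.star_eq_conjTranspose, Matrix.mul_assoc, Matrix.trace_mul_comm]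
  exact (hρ.mul_mul_conjTranspose_same C).trace_nonneg

lemma posSemidef_dyad {ι : Type} [Finite ι] (v : ι → ℂ) : (dyad v).PosSemidef :=
  Matrix.posSemidef_vecMulVec_self_star v

lemma one_sub_dyad_bb84 (θ z : Bool) : 1 - dyad (bb84 θ z) = dyad (bb84 θ (!z)) := by
  have h : ((Real.sqrt 2 : ℝ) : ℂ)⁻¹ * ((Real.sqrt 2 : ℝ) : ℂ)⁻¹ = 1 / 2 := by
    rw [← mul_inv, ← Complex.ofReal_mul, Real.mul_self_sqrt zero_le_two]
    norm_num
  ext i j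
  simp only [dyad, Matrix.sub_apply, Matrix.vecMulVec_apply, Pi.star_apply]
  cases θ <;> cases z <;> fin_cases i <;> fin_cases j <;> simp [bb84, h] <;> norm_num

lemma POVM.posSemidef_one_sub {ι : Type} [Fintype ι] [DecidableEq ι] (A : POVM ι)
    (z : Response) : (1 - A.op z).PosSemidef := by
  rw [← A.sum_eq_one, ← Finset.add_sum_erase _ _ (Finset.mem_univ z), add_sub_cancel_left]
  exact Matrix.posSemidef_sum _ fun i _ => A.posSemidef i

namespace Split

variable {q : ℕ} (s : Split q)

lemma jointOp_posSemidef {P : Matrix (Fin 2) (Fin 2) ℂ} {E : Matrix s.ARecv s.ARecv ℂ}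
    {F : Matrix s.BRecv s.BRecv ℂ} (hP : P.PosSemidef) (hE : E.PosSemidef)
    (hF : F.PosSemidef) : (s.jointOp P E F).PosSemidef := by
  have h := (hP.kronecker (hE.kronecker hF)).submatrix
    fun i : s.Final => (i.1, ((i.2.1.1, i.2.2.2), (i.2.2.1, i.2.1.2)))
  convert! h using 1
  ext i j
  simp [jointOp, mul_assoc]

lemma jointOp_one : s.jointOp 1 1 1 = 1 := by
  ext ⟨v, ⟨a, b⟩, c, d⟩ ⟨v', ⟨a', b'⟩, c', d'⟩
  simp only [jointOp, Matrix.of_apply, Matrix.one_apply, Prod.mk.injEq, ← ite_and, mul_ite,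
    mul_one, mul_zero]
  exact if_congr (by tauto) rfl rfl

lemma reduced_eq_sum (Ψ : s.PureFinal → ℂ) : s.reduced Ψ = ∑ pa, ∑ pb, ∑ p,
    dyad fun i : s.Final => Ψ (i.1, ((i.2.1, pa), (i.2.2, pb)), p) := by
  ext i j
  simp [reduced, Matrix.sum_apply, dyad, Matrix.vecMulVec_apply]

lemma reduced_posSemidef (Ψ : s.PureFinal → ℂ) : (s.reduced Ψ).PosSemidef := by
  rw [reduced_eq_sum]
  exact Matrix.posSemidef_sum _ fun _ _ => Matrix.posSemidef_sum _ fun _ _ =>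
    Matrix.posSemidef_sum _ fun _ _ => posSemidef_dyad _

lemma trace_reduced (Ψ : s.PureFinal → ℂ) : (s.reduced Ψ).trace = star Ψ ⬝ᵥ Ψ := by
  simp only [Matrix.trace, Matrix.diag_apply, reduced, Matrix.of_apply, dotProduct,
    Fintype.sum_prod_type, Pi.star_apply, mul_comm (star _)]
  refine Finset.sum_congr rfl fun v _ => ?_
  have hcomm : ∀ {X Y Z : Type} [Fintype X] [Fintype Y] [Fintype Z] (G : X → Y → Z → ℂ),
      ∑ x, ∑ y, ∑ z, G x y z = ∑ z, ∑ x, ∑ y, G x y z := by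
    intro X Y Z _ _ _ G
    rw [Finset.sum_comm' (s := Finset.univ (α := Z)) (t' := Finset.univ)
      (s' := fun _ => Finset.univ) (by simp)]
    exact Finset.sum_congr rfl fun x _ => Finset.sum_comm
  refine Finset.sum_congr rfl fun a₁ _ => Finset.sum_congr rfl fun a₂ _ => ?_
  rw [hcomm]

variable {s} {ρ : Matrix s.Final s.Final ℂ}

lemma prob_nonneg (hρ : ρ.PosSemidef) {P : Matrix (Fin 2) (Fin 2) ℂ}
    {E : Matrix s.ARecv s.ARecv ℂ} {F : Matrix s.BRecv s.BRecv ℂ} (hP : P.PosSemidef)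
    (hE : E.PosSemidef) (hF : F.PosSemidef) : 0 ≤ s.prob ρ P E F :=
  (Complex.nonneg_iff.1 (trace_mul_nonneg (s.jointOp_posSemidef hP hE hF) hρ)).1

lemma prob_sub_fst (P P' : Matrix (Fin 2) (Fin 2) ℂ) (E : Matrix s.ARecv s.ARecv ℂ)
    (F : Matrix s.BRecv s.BRecv ℂ) :
    s.prob ρ (P - P') E F = s.prob ρ P E F - s.prob ρ P' E F := by
  have h : s.jointOp (P - P') E F = s.jointOp P E F - s.jointOp P' E F := by
    ext
    simp [jointOp, sub_mul]
  rw [prob, h, Matrix.sub_mul, Matrix.trace_sub, Complex.sub_re, prob, prob]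

lemma prob_sub_snd (P : Matrix (Fin 2) (Fin 2) ℂ) (E E' : Matrix s.ARecv s.ARecv ℂ)
    (F : Matrix s.BRecv s.BRecv ℂ) :
    s.prob ρ P (E - E') F = s.prob ρ P E F - s.prob ρ P E' F := by
  have h : s.jointOp P (E - E') F = s.jointOp P E F - s.jointOp P E' F := by
    ext
    simp [jointOp, sub_mul, mul_sub]
  rw [prob, h, Matrix.sub_mul, Matrix.trace_sub, Complex.sub_re, prob, prob]

lemma prob_sub_trd (P : Matrix (Fin 2) (Fin 2) ℂ) (E : Matrix s.ARecv s.ARecv ℂ)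
    (F F' : Matrix s.BRecv s.BRecv ℂ) :
    s.prob ρ P E (F - F') = s.prob ρ P E F - s.prob ρ P E F' := by
  have h : s.jointOp P E (F - F') = s.jointOp P E F - s.jointOp P E F' := by
    ext
    simp [jointOp, mul_sub]
  rw [prob, h, Matrix.sub_mul, Matrix.trace_sub, Complex.sub_re, prob, prob]

/-- Enlarge the three factors to the identity one after another; each step adds a nonnegative
probability. -/
lemma prob_le_one (hρ : ρ.PosSemidef) (hρ₁ : ρ.trace = 1) {P : Matrix (Fin 2) (Fin 2) ℂ}
    (hP₁ : (1 - P).PosSemidef) (A : POVM s.ARecv) (B : POVM s.BRecv) (z z' : Response) :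
    s.prob ρ P (A.op z) (B.op z') ≤ 1 := by
  have h1 := prob_nonneg hρ hP₁ (A.posSemidef z) (B.posSemidef z')
  have h2 := prob_nonneg hρ Matrix.PosSemidef.one (A.posSemidef_one_sub z) (B.posSemidef z')
  have h3 := prob_nonneg hρ Matrix.PosSemidef.one Matrix.PosSemidef.one (B.posSemidef_one_sub z')
  rw [prob_sub_fst] at h1
  rw [prob_sub_snd] at h2
  rw [prob_sub_trd] at h3
  have h4 : s.prob ρ 1 1 1 = 1 := by
    rw [prob, jointOp_one, Matrix.one_mul, hρ₁, Complex.one_re]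
  linarith

lemma errorProb_nonneg (hρ : ρ.PosSemidef) (A : POVM s.ARecv) (B : POVM s.BRecv) (θ : Bool) :
    0 ≤ s.errorProb ρ A B θ :=
  Finset.sum_nonneg fun _ _ =>
    prob_nonneg hρ (posSemidef_dyad _) (A.posSemidef _) (B.posSemidef _)

/-- The crude constant is enough, as the bound only serves summability over the shared randomness.
-/
lemma errorProb_le_two (hρ : ρ.PosSemidef) (hρ₁ : ρ.trace = 1) (A : POVM s.ARecv)
    (B : POVM s.BRecv) (θ : Bool) : s.errorProb ρ A B θ ≤ 2 := by
  have h : ∀ z, s.prob ρ (dyad (bb84 θ z)) (A.op (some (!z))) (B.op (some (!z))) ≤ 1 := fun z =>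
    prob_le_one hρ hρ₁ (by rw [one_sub_dyad_bb84]; exact posSemidef_dyad _) A B _ _
  rw [errorProb, Fintype.sum_bool]
  linarith [h true, h false]

lemma transProb_le_one (hρ : ρ.PosSemidef) (A : POVM s.ARecv) (B : POVM s.BRecv) :
    s.transProb ρ A B ≤ 1 :=
  sub_le_self _ (prob_nonneg hρ Matrix.PosSemidef.one (A.posSemidef _) (B.posSemidef _))

lemma transProb_nonneg (hρ : ρ.PosSemidef) (hρ₁ : ρ.trace = 1) (A : POVM s.ARecv)
    (B : POVM s.BRecv) : 0 ≤ s.transProb ρ A B :=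
  sub_nonneg.2 (prob_le_one hρ hρ₁ (by rw [sub_self]; exact Matrix.PosSemidef.zero) A B _ _)

end Split

namespace SubStrategy

variable {n q : ℕ} (s : SubStrategy n q)

lemma finalState_posSemidef (xy : Bits n × Bits n) : (s.finalState xy).PosSemidef := by
  obtain ⟨U, W, ψ, -, -, -, h⟩ := s.exists_purification
  rw [h]
  exact s.split.reduced_posSemidef _

lemma trace_finalState (xy : Bits n × Bits n) : (s.finalState xy).trace = 1 := by
  obtain ⟨U, W, ψ, hU, hW, hψ, h⟩ := s.exists_purification
  rw [h, Split.trace_reduced, star_dotProduct_pureOutput _ (hU _) (hW _) hψ]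

lemma pe_nonneg (f : BasisFun n) (xy : Bits n × Bits n) : 0 ≤ s.pe f xy :=
  Split.errorProb_nonneg (s.finalState_posSemidef xy) _ _ _

lemma pe_le_two (f : BasisFun n) (xy : Bits n × Bits n) : s.pe f xy ≤ 2 :=
  Split.errorProb_le_two (s.finalState_posSemidef xy) (s.trace_finalState xy) _ _ _

lemma pt_nonneg (xy : Bits n × Bits n) : 0 ≤ s.pt xy :=
  Split.transProb_nonneg (s.finalState_posSemidef xy) (s.trace_finalState xy) _ _

lemma pt_le_one (xy : Bits n × Bits n) : s.pt xy ≤ 1 :=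
  Split.transProb_le_one (s.finalState_posSemidef xy) _ _

end SubStrategy

/-! ### From the size of the first class to the error rate -/

lemma card_inputs (n : ℕ) : Fintype.card (Bits n × Bits n) = 2 ^ (2 * n) := by
  simp [two_mul, pow_add]

namespace SubStrategy

variable {n q : ℕ} (s : SubStrategy n q)

/-- The first class of the partition controls the trade-off of transmission and error. -/
lemma transmission_le_of_cover (f : BasisFun n) {e t : ℝ} (he : 0 ≤ e) (ht₁ : t ≤ 1) :
    e * ∑ xy, s.pt xy ≤ e * (t * 2 ^ (2 * n) + (1 - t) *
      (({xy | s.pe f xy ≤ e ∧ t ≤ s.pt xy} : Set (Bits n × Bits n)).ncard : ℝ)) +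
        (1 - t) * ∑ xy, s.pe f xy := by
  classical
  have h1 : (({xy | s.pe f xy ≤ e ∧ t ≤ s.pt xy} : Set (Bits n × Bits n)).ncard : ℝ) =
      ∑ xy, if s.pe f xy ≤ e ∧ t ≤ s.pt xy then (1 : ℝ) else 0 := by
    rw [Set.ncard_eq_toFinset_card', Finset.sum_boole, Set.toFinset_ofPred]
  have h2 : (2 : ℝ) ^ (2 * n) = ∑ _xy : Bits n × Bits n, (1 : ℝ) := by
    rw [Finset.sum_const, Finset.card_univ, card_inputs]
    simp
  rw [h1, h2]
  simp only [Finset.mul_sum, ← Finset.sum_add_distrib]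
  -- The inequality holds at each input. In the class use `p_t ≤ 1`; if `p_e > e`, the right side is
  -- at least `e t + (1 - t) e = e`; if `p_t < t`, the term `e t` suffices.
  refine Finset.sum_le_sum fun xy _ => ?_
  have h3 := mul_le_mul_of_nonneg_left (s.pt_le_one xy) he
  have h4 := mul_nonneg (sub_nonneg.2 ht₁) (s.pe_nonneg f xy)
  split_ifs with h
  · nlinarith
  · rw [not_and_or, not_le, not_le] at h
    rcases h with h | h
    · nlinarith [mul_le_mul_of_nonneg_left h.le (sub_nonneg.2 ht₁)]
    · nlinarith [mul_le_mul_of_nonneg_left h.le he]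

/-- The four classes partition the matching pairs, so a total of `2^(2n)` leaves no other pair. The
first class is then cut out by its two inequalities alone. -/
lemma matchingAt_of_sum_ncard (f : BasisFun n) {e t : ℝ}
    (h : ∑ i, (s.inputClass f e t i).ncard = 2 ^ (2 * n)) (xy : Bits n × Bits n) :
    s.MatchingAt xy := by
  classical
  have hncard : ∀ A : Set (Bits n × Bits n), A.ncard = ∑ xy, if xy ∈ A then 1 else 0 := by
    intro A
    rw [Set.ncard_eq_toFinset_card', Finset.sum_boole, Nat.cast_id]
    congr 1
    ext
    simp
  have hcover : ∑ i, (s.inputClass f e t i).ncard = ({xy | s.MatchingAt xy} : Set _).ncard := by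
    simp only [hncard]
    rw [Finset.sum_comm]
    refine Finset.sum_congr rfl fun xy _ => ?_
    simp only [Fin.sum_univ_four, inputClass, Matrix.cons_val, Set.mem_ofPred_eq]
    by_cases h1 : s.pe f xy ≤ e <;> by_cases h2 : t ≤ s.pt xy <;>
      by_cases h3 : s.MatchingAt xy <;> simp [h1, h2, h3, not_lt.2, not_le.1]
  have huniv : ({xy | s.MatchingAt xy} : Set (Bits n × Bits n)) = Set.univ := by
    rw [Set.eq_univ_iff_ncard, ← hcover, h, Nat.card_eq_fintype_card, card_inputs]
  exact Set.eq_univ_iff_forall.1 huniv xy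

end SubStrategy

namespace Strategy

variable {n q : ℕ} (S : Strategy n q)

lemma summable_mul {g : S.R → ℝ} {C : ℝ} (h₀ : ∀ r, 0 ≤ g r) (h₁ : ∀ r, g r ≤ C) :
    Summable fun r => S.p r * g r :=
  Summable.of_nonneg_of_le (fun r => mul_nonneg (S.p_nonneg r) (h₀ r))
    (fun r => mul_le_mul_of_nonneg_left (h₁ r) (S.p_nonneg r)) (S.p_hasSum.summable.mul_right C)

lemma average_le {n : ℕ} {g : Bits n × Bits n → ℝ} {C : ℝ} (h : ∀ xy, g xy ≤ C) :
    (∑ xy, g xy) / (2 : ℝ) ^ (2 * n) ≤ C := by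
  rw [div_le_iff₀ (by positivity)]
  refine (Finset.sum_le_sum fun xy _ => h xy).trans ?_
  rw [Finset.sum_const, Finset.card_univ, card_inputs, nsmul_eq_mul, mul_comm]
  push_cast
  rfl

lemma average_nonneg {n : ℕ} {g : Bits n × Bits n → ℝ} (h : ∀ xy, 0 ≤ g xy) :
    0 ≤ (∑ xy, g xy) / (2 : ℝ) ^ (2 * n) :=
  div_nonneg (Finset.sum_nonneg fun xy _ => h xy) (by positivity)

variable {S} {f : BasisFun n} {ε η εthr ηthr ν : ℝ} {l : S.R → Fin 4 → ℕ}

lemma HasPartition.error_nonneg (h : S.HasPartition f ε η εthr ηthr l) (hη : 0 < η) : 0 ≤ ε := by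
  rw [← h.error_eq, h.transmission_eq]
  exact div_nonneg (tsum_nonneg fun r => mul_nonneg (S.p_nonneg r)
    (average_nonneg fun xy => (S.sub r).pe_nonneg f xy)) hη.le

/-- Unless some sub-strategy succeeds on many inputs, the error rate is large. -/
lemma HasPartition.le_error (h : S.HasPartition f ε η εthr ηthr l) (hη : 0 < η)
    (hεthr : 0 ≤ εthr) (hηthr₁ : ηthr < 1)
    (hl : ∀ r, (((S.sub r).inputClass f (εthr * η) ηthr 0).ncard : ℝ) ≤
      (1 - ν) * 2 ^ (2 * n)) :
    ((η - ηthr) / (1 - ηthr) - 1 + ν) * εthr ≤ ε := by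
  have he : 0 ≤ εthr * η := mul_nonneg hεthr hη.le
  have ht : 0 < 1 - ηthr := sub_pos.2 hηthr₁
  have hN : (0 : ℝ) < 2 ^ (2 * n) := by positivity
  have hr : ∀ r, εthr * η * ((∑ xy, (S.sub r).pt xy) / (2 : ℝ) ^ (2 * n)) ≤
      εthr * η * (ηthr + (1 - ηthr) * (1 - ν)) +
        (1 - ηthr) * ((∑ xy, (S.sub r).pe f xy) / (2 : ℝ) ^ (2 * n)) := by
    intro r
    have hmatch := (S.sub r).matchingAt_of_sum_ncard f (e := εthr * η) (t := ηthr) (by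
      rw [← h.sum_eq r]
      exact Finset.sum_congr rfl fun i _ => h.card_eq r i)
    have h0 : (S.sub r).inputClass f (εthr * η) ηthr 0 =
        {xy | (S.sub r).pe f xy ≤ εthr * η ∧ ηthr ≤ (S.sub r).pt xy} := by
      ext xy
      simp [SubStrategy.inputClass, hmatch xy]
    have h1 := (S.sub r).transmission_le_of_cover f he hηthr₁.le
    rw [← h0] at h1
    have h2 := mul_le_mul_of_nonneg_left (mul_le_mul_of_nonneg_left (hl r) ht.le) he
    rw [← sub_nonneg]
    have h3 : 0 ≤ (εthr * η * (ηthr * 2 ^ (2 * n) + (1 - ηthr) * ((1 - ν) * 2 ^ (2 * n))) +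
        (1 - ηthr) * ∑ xy, (S.sub r).pe f xy - εthr * η * ∑ xy, (S.sub r).pt xy) /
          2 ^ (2 * n) := div_nonneg (by linarith) hN.le
    convert! h3 using 1
    field_simp
  have hT : Summable fun r => S.p r * ((∑ xy, (S.sub r).pt xy) / (2 : ℝ) ^ (2 * n)) :=
    S.summable_mul (fun r => average_nonneg (S.sub r).pt_nonneg)
      (fun r => average_le (S.sub r).pt_le_one)
  have hE : Summable fun r => S.p r * ((∑ xy, (S.sub r).pe f xy) / (2 : ℝ) ^ (2 * n)) :=
    S.summable_mul (fun r => average_nonneg ((S.sub r).pe_nonneg f))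
      (fun r => average_le ((S.sub r).pe_le_two f))
  have hsum : εthr * η * S.transmission ≤
      1 * (εthr * η * (ηthr + (1 - ηthr) * (1 - ν))) + (1 - ηthr) * S.errorProb f := by
    refine hasSum_le (fun r => ?_) (hT.hasSum.mul_left (εthr * η))
      ((S.p_hasSum.mul_right _).add (hE.hasSum.mul_left (1 - ηthr)))
    have := mul_le_mul_of_nonneg_left (hr r) (S.p_nonneg r)
    linarith
  have herr : S.errorProb f = ε * η := by
    rw [← h.error_eq, h.transmission_eq, div_mul_cancel₀ _ hη.ne']
  rw [herr, h.transmission_eq] at hsum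
  -- Both the threshold `εthr * η` and the error probability `ε * η` carry a factor `η`, which
  -- cancels.
  have h4 : εthr * η ≤ εthr * (ηthr + (1 - ηthr) * (1 - ν)) + (1 - ηthr) * ε := by
    refine le_of_mul_le_mul_right ?_ hη
    linarith
  refine le_of_mul_le_mul_right ?_ ht
  have h5 : ((η - ηthr) / (1 - ηthr) - 1 + ν) * εthr * (1 - ηthr) =
      εthr * (η - ηthr - (1 - ηthr) * (1 - ν)) := by
    field_simp
    ring
  rw [h5]
  linarith

end Strategy

/-! ### Classical rounding -/

section Rounding

open scoped Matrix.Norms.L2Operator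

lemma finrank_real_matrix {m m' : Type*} [Fintype m] [Fintype m'] [DecidableEq m]
    [DecidableEq m'] :
    Module.finrank ℝ (Matrix m' m ℂ) = 2 * (Fintype.card m' * Fintype.card m) := by
  rw [finrank_real_of_complex, Module.finrank_matrix, Module.finrank_self, mul_one]

variable {q : ℕ} (s : Split q)

lemma exists_finset_net_unitary {m m' : Type} [Fintype m] [Fintype m'] [DecidableEq m]
    [DecidableEq m'] {ε : ℝ} (hε : 0 < ε) {d : ℕ}
    (hd : 2 * (Fintype.card m' * Fintype.card m) = d) :
    ∃ N : Finset (Matrix m' m ℂ), (∀ U ∈ N, IsUnitary U) ∧ (N.card : ℝ) ≤ (1 + 2 / ε) ^ d ∧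
      ∀ U, IsUnitary U → ∃ U' ∈ N, ‖U - U'‖ < ε := by
  obtain ⟨N, h1, h2, h3⟩ := exists_finset_net hε {U : Matrix m' m ℂ | IsUnitary U}
    fun U hU => l2_opNorm_le_one_of_conjTranspose_mul_self hU.2
  refine ⟨N, h1, ?_, h3⟩
  rwa [finrank_real_matrix, hd] at h2

lemma exists_finset_net_unit {ι : Type} [Fintype ι] {ε : ℝ} (hε : 0 < ε) {d : ℕ}
    (hd : 2 * Fintype.card ι = d) :
    ∃ N : Finset (ι → ℂ), (∀ ψ ∈ N, star ψ ⬝ᵥ ψ = 1) ∧ (N.card : ℝ) ≤ (1 + 2 / ε) ^ d ∧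
      ∀ ψ : ι → ℂ, star ψ ⬝ᵥ ψ = 1 → ∃ ψ' ∈ N, ‖WithLp.toLp 2 (ψ - ψ')‖ < ε := by
  classical
  obtain ⟨N, h1, h2, h3⟩ := exists_finset_net hε
    {ψ : EuclideanSpace ℂ ι | star ψ.ofLp ⬝ᵥ ψ.ofLp = 1}
    fun ψ hψ => (norm_toLp_eq_one hψ).le
  refine ⟨N.image WithLp.ofLp, ?_, ?_, fun ψ hψ => ?_⟩
  · intro ψ hψ
    obtain ⟨φ, hφ, rfl⟩ := Finset.mem_image.1 hψ
    exact h1 φ hφ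
  · rw [finrank_real_of_complex, finrank_euclideanSpace, hd] at h2
    exact (Nat.cast_le.2 Finset.card_image_le).trans h2
  · obtain ⟨φ, hφ, h⟩ := h3 (WithLp.toLp 2 ψ) hψ
    exact ⟨φ.ofLp, Finset.mem_image_of_mem _ hφ, h⟩

/-- Close to a vector of `outputStates θ` there are no vectors of `outputStates (!θ)`; hence the
basis can be read off from an approximation. -/
def roundedBasis (e t δ : ℝ) (Φ : s.PureFinal → ℂ) : Bool :=
  open Classical in
  if ∃ Ψ ∈ s.outputStates false e t, ‖WithLp.toLp 2 (Ψ - Φ)‖ < δ / 2 then false else true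

lemma star_dotProduct_outputStates {θ : Bool} {e t : ℝ} {Ψ : s.PureFinal → ℂ}
    (h : Ψ ∈ s.outputStates θ e t) : star Ψ ⬝ᵥ Ψ = 1 := by
  obtain ⟨⟨U, W, ψ, hU, hW, hψ, rfl⟩, -⟩ := h
  exact star_dotProduct_pureOutput s hU hW hψ

/-- Vectors of both sets within `δ / 2` of `Φ` would be less than `δ` apart in norm, hence in trace
distance, against the separation. -/
lemma roundedBasis_eq {e t δ : ℝ} (hsep : SeparatedBy q e t δ) {θ : Bool}
    {Ψ Φ : s.PureFinal → ℂ} (hΨ : Ψ ∈ s.outputStates θ e t)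
    (h : ‖WithLp.toLp 2 (Ψ - Φ)‖ < δ / 2) : roundedBasis s e t δ Φ = θ := by
  cases θ with
  | false => exact if_pos ⟨Ψ, hΨ, h⟩
  | true =>
    refine if_neg ?_
    rintro ⟨Ψ₀, hΨ₀, h₀⟩
    have h1 := (hsep s Ψ₀ hΨ₀ Ψ hΨ).trans (traceDist_dyad_le
      (star_dotProduct_outputStates s hΨ₀) (star_dotProduct_outputStates s hΨ))
    have h2 : WithLp.toLp 2 (Ψ₀ - Ψ) = WithLp.toLp 2 (Ψ₀ - Φ) - WithLp.toLp 2 (Ψ - Φ) := by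
      rw [← WithLp.toLp_sub, sub_sub_sub_cancel_right]
    rw [h2] at h1
    linarith [norm_sub_le (WithLp.toLp 2 (Ψ₀ - Φ)) (WithLp.toLp 2 (Ψ - Φ))]

/-- Classical rounding: a small set of functions contains, for every choice of the unitaries and
the shared state, one that agrees with the basis wherever the output state determines it. -/
lemma exists_rounding (n : ℕ) {e t δ : ℝ} (hδ : 0 < δ) (hsep : SeparatedBy q e t δ) :
    ∃ G : Finset (BasisFun n),
      (G.card : ℝ) ≤ (1 + 12 / δ) ^ (2 ^ (6 * q + 7) * 2 ^ n + 2 ^ (6 * q + 1) * 2 ^ n +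
        2 ^ (4 * q + 1)) ∧
      ∀ (U : Bits n → Matrix (s.AOut × PurA q) ((Qubits q × Fin 2) × PurA q) ℂ)
        (W : Bits n → Matrix (s.BOut × PurB q) (Qubits q × PurB q) ℂ)
        (ψ : (Qubits q × Qubits q) × PurP q → ℂ),
        (∀ x, IsUnitary (U x)) → (∀ y, IsUnitary (W y)) → star ψ ⬝ᵥ ψ = 1 →
        ∃ g ∈ G, ∀ xy θ, s.pureOutput (U xy.1) (W xy.2) ψ ∈ s.outputStates θ e t →
          g xy = θ := by
  classical
  -- Three approximations, each with error below `δ / 6`, stay within the `δ / 2` that rounding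
  -- tolerates; the net bound `1 + 2 / ε` becomes `1 + 12 / δ`.
  have hε : 0 < δ / 6 := by positivity
  have hA : 2 * (Fintype.card (s.AOut × PurA q) *
      Fintype.card ((Qubits q × Fin 2) × PurA q)) = 2 ^ (6 * q + 7) := by
    simp only [Fintype.card_prod, Fintype.card_fin, ← pow_add, s.alice_eq]
    ring
  have hB : 2 * (Fintype.card (s.BOut × PurB q) * Fintype.card (Qubits q × PurB q)) =
      2 ^ (6 * q + 1) := by
    simp only [Fintype.card_prod, Fintype.card_fin, ← pow_add, s.bob_eq]
    ring
  have hP : 2 * Fintype.card ((Qubits q × Qubits q) × PurP q) = 2 ^ (4 * q + 1) := by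
    simp only [Fintype.card_prod, Fintype.card_fin]
    ring
  obtain ⟨NA, hNA, hNAc, hNAn⟩ := exists_finset_net_unitary hε hA
  obtain ⟨NB, hNB, hNBc, hNBn⟩ := exists_finset_net_unitary hε hB
  obtain ⟨NP, hNP, hNPc, hNPn⟩ := exists_finset_net_unit hε hP
  have hbase : 1 + 2 / (δ / 6) = 1 + 12 / δ := by
    field_simp
    norm_num
  rw [hbase] at hNAc hNBc hNPc
  -- One net point per `x`, one per `y` and one shared state: hence the factors `2 ^ n` on the first
  -- two exponents only.
  let g : (Bits n → NA) × (Bits n → NB) × NP → BasisFun n := fun c xy =>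
    roundedBasis s e t δ (s.pureOutput (c.1 xy.1) (c.2.1 xy.2) c.2.2)
  refine ⟨Finset.univ.image g, ?_, fun U W ψ hU hW hψ => ?_⟩
  · refine (Nat.cast_le.2 Finset.card_image_le).trans ?_
    simp only [Finset.card_univ, Fintype.card_prod, Fintype.card_fun, Fintype.card_coe,
      Fintype.card_bool, Fintype.card_fin, Nat.cast_mul, Nat.cast_pow]
    rw [pow_add, pow_add, mul_assoc, pow_mul, pow_mul]
    gcongr
  · choose U' hU' hUU' using fun x => hNAn (U x) (hU x)
    choose W' hW' hWW' using fun y => hNBn (W y) (hW y)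
    obtain ⟨ψ', hψ', hψψ'⟩ := hNPn ψ hψ
    refine ⟨_, Finset.mem_image_of_mem g (Finset.mem_univ
      (fun x => ⟨U' x, hU' x⟩, fun y => ⟨W' y, hW' y⟩, ⟨ψ', hψ'⟩)), fun xy θ hθ => ?_⟩
    refine roundedBasis_eq s hsep hθ ((norm_pureOutput_sub_le s (hNA _ (hU' xy.1)) (hW xy.2)
      (hNB _ (hW' xy.2)) hψ).trans_lt ?_)
    linarith [hUU' xy.1, hWW' xy.2]

end Rounding

/-! ### Counting the functions that can be attacked -/

lemma finite_split (q : ℕ) : Finite (Split q) ∧ Nat.card (Split q) ≤ 2 ^ (2 * q + 1) := by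
  let F : Split q → Fin (2 ^ (q + 1)) × Fin (2 ^ q) := fun s =>
    (⟨s.a₁, (Nat.le_add_right _ _).trans_lt (s.alice_eq.trans_lt Nat.lt_two_pow_self)⟩,
      ⟨s.b₁, (Nat.le_add_right _ _).trans_lt (s.bob_eq.trans_lt Nat.lt_two_pow_self)⟩)
  have hF : Function.Injective F := by
    rintro ⟨a₁, a₂, b₁, b₂, ha, hb⟩ ⟨a₁', a₂', b₁', b₂', ha', hb'⟩ h
    simp only [F, Prod.mk.injEq, Fin.mk.injEq] at h
    simp only [Split.mk.injEq]
    omega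
  refine ⟨Finite.of_injective F hF, (Nat.card_le_card_of_injective F hF).trans ?_⟩
  rw [Nat.card_eq_fintype_card, Fintype.card_prod, Fintype.card_fin, Fintype.card_fin, ← pow_add]
  exact Nat.pow_le_pow_right two_pos (by omega)

lemma card_basisFun (n : ℕ) : (Fintype.card (BasisFun n) : ℝ) = (2 : ℝ) ^ ((2 : ℝ) ^ (2 * n)) := by
  rw [Fintype.card_fun, card_inputs, Fintype.card_bool]
  push_cast
  rw [← Real.rpow_natCast]
  push_cast
  rfl

open Finset in
/-- Sub-strategies that succeed on many inputs exist only for few functions. -/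
lemma card_attackable_le {n q : ℕ} {e t δ ν : ℝ} (hδ : 0 < δ) (hsep : SeparatedBy q e t δ)
    (hν₀ : 0 ≤ ν) (hν₁ : ν ≤ 1 / 2) :
    (({f | ∃ s : SubStrategy n q, (1 - ν) * 2 ^ (2 * n) < ((s.inputClass f e t 0).ncard : ℝ)} :
      Set (BasisFun n)).ncard : ℝ) ≤
      2 ^ (2 * q + 1) * (1 + 12 / δ) ^ (2 ^ (6 * q + 7) * 2 ^ n + 2 ^ (6 * q + 1) * 2 ^ n +
        2 ^ (4 * q + 1)) * (2 : ℝ) ^ ((2 : ℝ) ^ (2 * n) * hb ν) := by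
  classical
  obtain ⟨hfin, hcard⟩ := finite_split q
  let _ : Fintype (Split q) := Fintype.ofFinite _
  choose G hGc hG using fun s : Split q => exists_rounding s n hδ hsep
  let ball : BasisFun n → Finset (BasisFun n) := fun g =>
    {f | (#{xy | f xy ≠ g xy} : ℝ) < ν * Fintype.card (Bits n × Bits n)}
  have hball : ∀ g, (#(ball g) : ℝ) ≤ (2 : ℝ) ^ ((2 : ℝ) ^ (2 * n) * hb ν) := by
    intro g
    refine (card_hammingBall_le g hν₀ hν₁).trans_eq ?_
    rw [card_inputs]
    push_cast
    rfl
  have hsub : {f | ∃ s : SubStrategy n q,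
      (1 - ν) * 2 ^ (2 * n) < ((s.inputClass f e t 0).ncard : ℝ)} ⊆
        (((univ : Finset (Split q)).biUnion fun s => (G s).biUnion ball :
          Finset (BasisFun n)) : Set (BasisFun n)) := by
    rintro f ⟨s, hs⟩
    obtain ⟨U, W, ψ, hU, hW, hψ, hρ⟩ := s.exists_purification
    obtain ⟨g, hgG, hg⟩ := hG s.split U W ψ hU hW hψ
    -- On the first class the given POVMs put the output vector into the set of basis `f xy`, so `g`
    -- takes that value; thus `f` and `g` differ on fewer than `ν 2^(2n)` inputs.
    have hagree : s.inputClass f e t 0 ⊆ (({xy | ¬ f xy ≠ g xy} : Finset (Bits n × Bits n)) :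
        Set (Bits n × Bits n)) := by
      rintro xy ⟨h1, h2, h3⟩
      rw [SubStrategy.pe, hρ] at h1
      rw [SubStrategy.pt, hρ] at h2
      rw [SubStrategy.MatchingAt, hρ] at h3
      simp only [coe_filter, mem_univ, true_and, not_not, Set.mem_ofPred_eq]
      exact (hg xy (f xy) ⟨⟨_, _, ψ, hU _, hW _, hψ, rfl⟩, _, _, h1, h2, h3⟩).symm
    have h1 := Set.ncard_le_ncard hagree (Set.toFinite _)
    rw [Set.ncard_coe_finset] at h1
    have h2 := card_filter_add_card_filter_not (s := (univ : Finset (Bits n × Bits n)))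
      (fun xy => f xy ≠ g xy)
    rw [card_univ, card_inputs] at h2
    have h3 : (#{xy | f xy ≠ g xy} : ℝ) + (#{xy | ¬ f xy ≠ g xy} : ℝ) = 2 ^ (2 * n) := by
      exact_mod_cast h2
    have h4 : ((s.inputClass f e t 0).ncard : ℝ) ≤ (#{xy | ¬ f xy ≠ g xy} : ℝ) := by
      exact_mod_cast h1
    simp only [coe_biUnion, Set.mem_iUnion, mem_coe, mem_univ]
    refine ⟨s.split, trivial, g, hgG, mem_filter.2 ⟨mem_univ _, ?_⟩⟩
    rw [card_inputs]
    push_cast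
    linarith
  have h1 := Set.ncard_le_ncard hsub (Set.toFinite _)
  rw [Set.ncard_coe_finset] at h1
  have hδ' : 0 ≤ 1 + 12 / δ := by positivity
  set D := 2 ^ (6 * q + 7) * 2 ^ n + 2 ^ (6 * q + 1) * 2 ^ n + 2 ^ (4 * q + 1)
  set V := (2 : ℝ) ^ ((2 : ℝ) ^ (2 * n) * hb ν) with hV
  have hV0 : 0 ≤ V := by positivity
  have hs : ∀ s, (#((G s).biUnion ball) : ℝ) ≤ (1 + 12 / δ) ^ D * V := by
    intro s
    refine (Nat.cast_le.2 card_biUnion_le).trans ?_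
    rw [Nat.cast_sum]
    refine (sum_le_sum fun g _ => hball g).trans ?_
    rw [sum_const, nsmul_eq_mul]
    exact mul_le_mul_of_nonneg_right (hGc s) hV0
  refine (Nat.cast_le.2 (h1.trans card_biUnion_le)).trans ?_
  rw [Nat.cast_sum]
  refine (sum_le_sum fun s _ => hs s).trans ?_
  rw [sum_const, nsmul_eq_mul, mul_assoc]
  refine mul_le_mul_of_nonneg_right ?_ (mul_nonneg (pow_nonneg hδ' _) hV0)
  rw [card_univ, ← Nat.card_eq_fintype_card]
  exact_mod_cast hcard

/-- The net exponent and the splitting exponent `2q + 1` are both at most `2^(6q+n+8)`, and `6q ≤ n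
- 6q₀`. The `+ 1` next to the ceiling pays for the splittings. -/
lemma rounding_size_le {n q : ℕ} {q₀ δ : ℝ} (hq : (q : ℝ) ≤ (1 / 6 : ℝ) * n - q₀) (hδ : 0 < δ) :
    2 ^ (2 * q + 1) * (1 + 12 / δ) ^ (2 ^ (6 * q + 7) * 2 ^ n + 2 ^ (6 * q + 1) * 2 ^ n +
        2 ^ (4 * q + 1)) ≤
      (2 : ℝ) ^ ((2 : ℝ) ^ (9 - 6 * q₀) * ((⌈Real.logb 2 (1 + 12 / δ)⌉ : ℝ) + 1) *
        (2 : ℝ) ^ (2 * n)) := by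
  have hb : 1 ≤ 1 + 12 / δ := by
    have : 0 < 12 / δ := by positivity
    linarith
  have hb0 : 0 < 1 + 12 / δ := by linarith
  set L : ℝ := (⌈Real.logb 2 (1 + 12 / δ)⌉ : ℝ) with hL
  have hlogL : Real.logb 2 (1 + 12 / δ) ≤ L := Int.le_ceil _
  have hL0 : 0 ≤ L := (Real.logb_nonneg one_lt_two hb).trans hlogL
  have hbL : 1 + 12 / δ ≤ (2 : ℝ) ^ L := by
    rwa [← Real.logb_le_iff_le_rpow one_lt_two hb0]
  have hexp : (2 : ℝ) ^ (6 * q + n + 8) ≤ (2 : ℝ) ^ (9 - 6 * q₀) * (2 : ℝ) ^ (2 * n) := by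
    rw [← Real.rpow_natCast, ← Real.rpow_natCast, ← Real.rpow_add two_pos]
    refine Real.rpow_le_rpow_of_exponent_le one_le_two ?_
    push_cast
    linarith
  set D := 2 ^ (6 * q + 7) * 2 ^ n + 2 ^ (6 * q + 1) * 2 ^ n + 2 ^ (4 * q + 1) with hD
  have hD1 : D ≤ 2 ^ (6 * q + n + 8) := by
    have h1 : 2 ^ (4 * q + 1) ≤ 2 ^ (6 * q + n + 1) :=
      Nat.pow_le_pow_right two_pos (by omega)
    have h2 : 2 ^ (6 * q + n + 1) = 2 ^ (6 * q + n) * 2 := pow_succ _ _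
    have h3 : 2 ^ (6 * q + 7) * 2 ^ n = 2 ^ (6 * q + n) * 128 := by ring
    have h4 : 2 ^ (6 * q + 1) * 2 ^ n = 2 ^ (6 * q + n) * 2 := by ring
    have h5 : 2 ^ (6 * q + n + 8) = 2 ^ (6 * q + n) * 256 := by ring
    omega
  have hS : 2 * q + 1 ≤ 2 ^ (6 * q + n + 8) :=
    Nat.lt_two_pow_self.le.trans (Nat.pow_le_pow_right two_pos (by omega))
  have hD1' : (D : ℝ) ≤ 2 ^ (6 * q + n + 8) := by exact_mod_cast hD1
  have hS' : ((2 * q + 1 : ℕ) : ℝ) ≤ 2 ^ (6 * q + n + 8) := by exact_mod_cast hS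
  calc (2 : ℝ) ^ (2 * q + 1) * (1 + 12 / δ) ^ D
      ≤ (2 : ℝ) ^ (2 * q + 1) * ((2 : ℝ) ^ L) ^ D := by gcongr
    _ = (2 : ℝ) ^ (((2 * q + 1 : ℕ) : ℝ) + L * D) := by
        rw [Real.rpow_add two_pos, Real.rpow_natCast, Real.rpow_mul zero_le_two,
          Real.rpow_natCast]
    _ ≤ _ := by
        refine Real.rpow_le_rpow_of_exponent_le one_le_two ?_
        nlinarith [mul_le_mul_of_nonneg_left hD1' hL0, mul_le_mul_of_nonneg_right hexp hL0]

lemma probFun_compl {n : ℕ} (E : Set (BasisFun n)) : probFun Eᶜ = 1 - probFun E := by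
  have h := Set.ncard_add_ncard_compl E
  rw [Nat.card_eq_fintype_card] at h
  have h0 : (Fintype.card (BasisFun n) : ℝ) ≠ 0 := by
    rw [card_basisFun]
    positivity
  rw [probFun, probFun, eq_sub_iff_add_eq, ← add_div, div_eq_one_iff_eq h0, add_comm]
  exact_mod_cast h

lemma probFun_mono {n : ℕ} {E F : Set (BasisFun n)} (h : E ⊆ F) : probFun E ≤ probFun F := by
  rw [probFun, probFun]
  gcongr
  exact Set.toFinite F

lemma mul_probFun_le_meanFun {n : ℕ} {E : Set (BasisFun n)} {X : BasisFun n → ℝ} {c : ℝ}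
    (hX : ∀ f, 0 ≤ X f) (hE : ∀ f ∈ E, c ≤ X f) : probFun E * c ≤ meanFun X := by
  classical
  rw [probFun, meanFun, div_mul_eq_mul_div, Set.ncard_eq_toFinset_card', ← nsmul_eq_mul]
  refine div_le_div_of_nonneg_right ?_ (Nat.cast_nonneg _)
  exact (Finset.card_nsmul_le_sum _ _ _ fun f hf => hE f (Set.mem_toFinset.1 hf)).trans
    (Finset.sum_le_univ_sum_of_nonneg hX)

/-- For all but a fraction `2^{-α}` of the functions, no sub-strategy succeeds on many inputs. -/
lemma probFun_attackable_le {n q : ℕ} {q₀ α e t δ ν : ℝ}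
    (hq : (q : ℝ) ≤ (1 / 6 : ℝ) * n - q₀) (hδ : 0 < δ) (hsep : SeparatedBy q e t δ)
    (hν₀ : 0 ≤ ν) (hν₁ : ν ≤ 1 / 2)
    (hν : hb ν = 1 - (2 : ℝ) ^ (9 - 6 * q₀) * ((⌈Real.logb 2 (1 + 12 / δ)⌉ : ℝ) + 1)
      - α / (2 : ℝ) ^ (2 * n)) :
    probFun {f : BasisFun n | ∃ s : SubStrategy n q,
      (1 - ν) * 2 ^ (2 * n) < ((s.inputClass f e t 0).ncard : ℝ)} ≤ (2 : ℝ) ^ (-α) := by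
  rw [probFun, card_basisFun, div_le_iff₀ (by positivity)]
  refine (card_attackable_le hδ hsep hν₀ hν₁).trans ?_
  refine (mul_le_mul_of_nonneg_right (rounding_size_le hq hδ) (by positivity)).trans_eq ?_
  -- By the equation for `ν`, the exponents of the rounding count and of the ball volume add up to
  -- exactly `2^(2n) - α`.
  rw [← Real.rpow_add two_pos, ← Real.rpow_add two_pos, hν]
  congr 1
  field_simp
  ring

end QPV

end

theorem mainTheorem4 (n q : ℕ) (q₀ α εthr ηthr η δ ν : ℝ)
    (hq : (q : ℝ) ≤ (1 / 6 : ℝ) * n - q₀) (hα : 0 ≤ α)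
    (hεthr : 0 ≤ εthr) (hηthr₀ : 0 ≤ ηthr) (hηthr₁ : ηthr < 1) (hη : 0 < η)
    (hδ : 0 < δ) (hsep : QPV.SeparatedBy q (εthr * η) ηthr δ)
    (hν₀ : 0 ≤ ν) (hν₁ : ν ≤ 1 / 2)
    (hν : QPV.hb ν = 1 - (2 : ℝ) ^ (9 - 6 * q₀) * ((⌈Real.logb 2 (1 + 12 / δ)⌉ : ℝ) + 1)
      - α / (2 : ℝ) ^ (2 * n)) :
    (1 - (2 : ℝ) ^ (-α) ≤ QPV.probFun {f : QPV.BasisFun n |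
      ∀ (S : QPV.Strategy n q) (ε : ℝ) (l : S.R → Fin 4 → ℕ),
        S.HasPartition f ε η εthr ηthr l →
          ((η - ηthr) / (1 - ηthr) - 1 + ν) * εthr ≤ ε}) ∧
    (∀ (S : QPV.BasisFun n → QPV.Strategy n q) (ε : QPV.BasisFun n → ℝ)
      (l : ∀ f, (S f).R → Fin 4 → ℕ),
        (∀ f, (S f).HasPartition f (ε f) η εthr ηthr (l f)) →
          (1 - (2 : ℝ) ^ (-α)) * ((η - ηthr) / (1 - ηthr) - 1 + ν) * εthr ≤ QPV.meanFun ε) := by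
  set c := ((η - ηthr) / (1 - ηthr) - 1 + ν) * εthr with hc
  have hprob : 1 - (2 : ℝ) ^ (-α) ≤ QPV.probFun {f : QPV.BasisFun n |
      ∀ (S : QPV.Strategy n q) (ε : ℝ) (l : S.R → Fin 4 → ℕ),
        S.HasPartition f ε η εthr ηthr l → c ≤ ε} := by
    have h := QPV.probFun_attackable_le hq hδ hsep hν₀ hν₁ hν
    refine (sub_le_sub_left h 1).trans ?_
    rw [← QPV.probFun_compl]
    refine QPV.probFun_mono fun f hf S ε l hS => hS.le_error hη hεthr hηthr₁ fun r => ?_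
    by_contra! hr
    exact hf ⟨S.sub r, hr⟩
  refine ⟨hprob, fun S ε l hS => ?_⟩
  have hε : ∀ f, 0 ≤ ε f := fun f => (hS f).error_nonneg hη
  have hα₁ : (2 : ℝ) ^ (-α) ≤ 1 := Real.rpow_le_one_of_one_le_of_nonpos one_le_two (by linarith)
  rw [mul_assoc, ← hc]
  -- For `c ≤ 0` the claim follows from `ε f ≥ 0`; otherwise it is Markov's inequality on the good
  -- event.
  rcases le_total c 0 with hc₀ | hc₀
  · refine (mul_nonpos_of_nonneg_of_nonpos (sub_nonneg.2 hα₁) hc₀).trans ?_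
    exact div_nonneg (Finset.sum_nonneg fun f _ => hε f) (Nat.cast_nonneg _)
  · exact (mul_le_mul_of_nonneg_right hprob hc₀).trans
      (QPV.mul_probFun_le_meanFun hε fun f hf => hf (S f) (ε f) (l f) (hS f))
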